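/- All graphs are finite, simple and undirected. A tree decomposition of a graph $G=(V,E)$ is a finite tree $\mathcal T$ together with a bag $B_i\subseteq V$ for every node $i$ of $\mathcal T$ such that every vertex of $G$ lies in some bag, both ends of every edge of $G$ lie in a common bag, and for every $a\in V$ the nodes $i$ with $a\in B_i$ induce a connected subtree of $\mathcal T$. Its width is $\max_i|B_i|-1$, and the treewidth $\mathrm{w}(G)$ is the minimum width of the tree decompositions of $G$. The splitting of a vertex $v$ of $G$ with support $S\subseteq N(v)$ adds a new vertex $v'$, joins $v'$ to $v$, and for every $s\in S$ deletes the edge $sv$ and adds the edge $sv'$. A graph $G'$ is an expansion of $G$ if it is obtained (up to isomorphism) from $G$ by a finite sequence of splittings; the expansion is ternary if $G'$ has maximum degree at most $3$. Theorem. There is a polynomial-time algorithm that, given a graph $G$ and a tree decomposition of $G$ of width $w$, computes a ternary expansion $G'$ of $G$ with $\mathrm{w}(G')\le w+1$. In particular, every graph $G$ has a ternary expansion $G'$ with $\mathrm{w}(G')\le \mathrm{w}(G)+1$. -/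

import Mathlib

universe u v

namespace GraphExpansion

/-! ### Tree decompositions and treewidth -/

/-- A tree decomposition of the graph `G` whose tree has node set `ι`. -/
structure TreeDecomposition {V : Type u} (G : SimpleGraph V) (ι : Type v) where
  /-- the tree -/
  tree : SimpleGraph ι
  isTree : tree.IsTree
  /-- the bag of a node of the tree -/
  bag : ι → Finset V
  exists_mem_bag : ∀ a : V, ∃ i, a ∈ bag i
  exists_edge_bag : ∀ a b : V, G.Adj a b → ∃ i, a ∈ bag i ∧ b ∈ bag i
  connected : ∀ a : V, (tree.induce {i | a ∈ bag i}).Connected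

/-- The width: the maximal size of a bag, minus one (an integer: the width is `-1` if all
bags are empty). -/
def TreeDecomposition.width {V : Type u} {G : SimpleGraph V} {ι : Type v} [Fintype ι]
    (D : TreeDecomposition G ι) : ℤ :=
  ((Finset.univ.sup fun i => (D.bag i).card : ℕ) : ℤ) - 1

/-- The treewidth of a finite graph: the minimum width of its tree decompositions (whose trees
are, up to isomorphism, trees on `Fin m`). -/
noncomputable def treewidth {V : Type u} (G : SimpleGraph V) : ℤ :=
  sInf {k : ℤ | ∃ (m : ℕ) (D : TreeDecomposition G (Fin m)), D.width = k}

/-! ### Splittings and expansions -/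

/-- The splitting of the vertex `a` with support `S` (used for `S ⊆ N(a)`): the new vertex `none`
is connected to `a`, and each `s ∈ S` is disconnected from `a` and connected to `none`. -/
def splitting {V : Type u} (G : SimpleGraph V) (a : V) (S : Set V) :
    SimpleGraph (Option V) where
  Adj
    | none, none => False
    | none, some y => y = a ∨ y ∈ S
    | some x, none => x = a ∨ x ∈ S
    | some x, some y => G.Adj x y ∧ ¬ (x = a ∧ y ∈ S) ∧ ¬ (y = a ∧ x ∈ S)
  symm := ⟨by
    rintro (_ | x) (_ | y) h
    · exact h
    · exact h
    · exact h
    · exact ⟨h.1.symm, h.2.2, h.2.1⟩⟩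
  loopless := ⟨by
    rintro (_ | x) h
    · exact h
    · exact G.irrefl h.1⟩

/-- `IsExpansion G H`: the graph `H` arises from `G`, up to isomorphism (the names of the vertices
are immaterial), by a finite sequence of splittings. -/
inductive IsExpansion {V : Type u} (G : SimpleGraph V) :
    {W : Type v} → SimpleGraph W → Prop
  | iso {W : Type v} {H : SimpleGraph W} (e : G ≃g H) : IsExpansion G H
  | split {W W' : Type v} {H : SimpleGraph W} {H' : SimpleGraph W'} (a : W) (S : Set W)
      (hS : S ⊆ H.neighborSet a) (e : splitting H a S ≃g H') (h : IsExpansion G H) :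
      IsExpansion G H'

/-- A graph is ternary if its maximum degree is at most three. -/
def IsTernary {V : Type u} (G : SimpleGraph V) : Prop :=
  ∀ a : V, (G.neighborSet a).encard ≤ 3

/-! ### Random access machines with a step count

A program works on natural numbers. It has registers, arrays with indirect addressing (a program
mentions only finitely many of either, each by a constant name), and a write-only output tape.
Every assignment, memory access, output and test costs one step. The only arithmetic operations
are addition and truncated subtraction, so that the largest number at most doubles in one step, and
the step count is polynomially related to the running time of Turing machines. -/

/-- Programs. -/
inductive Program
  /-- do nothing -/
  | skip
  /-- `R[x] := c` for a constant `c` -/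
  | const (x c : ℕ)
  /-- `R[x] := R[y] + R[z]` -/
  | add (x y z : ℕ)
  /-- `R[x] := R[y] - R[z]`, or `0` if this is negative -/
  | sub (x y z : ℕ)
  /-- `R[x] := A_k[R[y]]` -/
  | load (x k y : ℕ)
  /-- `A_k[R[x]] := R[y]` -/
  | store (k x y : ℕ)
  /-- append `R[x]` to the output tape -/
  | write (x : ℕ)
  /-- first `c`, then `d` -/
  | seq (c d : Program)
  /-- if `R[x] ≠ 0` then `c` else `d` -/
  | cond (x : ℕ) (c d : Program)
  /-- while `R[x] ≠ 0` do `c` -/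
  | loop (x : ℕ) (c : Program)

/-- Configurations of the memory. -/
structure Store where
  /-- the registers -/
  reg : ℕ → ℕ
  /-- `arr k i` is the cell `i` of the array `A_k` -/
  arr : ℕ → ℕ → ℕ
  /-- the output tape -/
  out : List ℕ

/-- `R[x] := val`. -/
def Store.setReg (s : Store) (x val : ℕ) : Store :=
  { s with reg := Function.update s.reg x val }

/-- `A_k[i] := val`. -/
def Store.setArr (s : Store) (k i val : ℕ) : Store :=
  { s with arr := Function.update s.arr k (Function.update (s.arr k) i val) }

/-- `Exec c s s' t`: the program `c`, started in `s`, halts in `s'` after `t` steps. -/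
inductive Exec : Program → Store → Store → ℕ → Prop
  | skip (s : Store) : Exec .skip s s 1
  | const (x c : ℕ) (s : Store) : Exec (.const x c) s (s.setReg x c) 1
  | add (x y z : ℕ) (s : Store) : Exec (.add x y z) s (s.setReg x (s.reg y + s.reg z)) 1
  | sub (x y z : ℕ) (s : Store) : Exec (.sub x y z) s (s.setReg x (s.reg y - s.reg z)) 1
  | load (x k y : ℕ) (s : Store) : Exec (.load x k y) s (s.setReg x (s.arr k (s.reg y))) 1
  | store (k x y : ℕ) (s : Store) : Exec (.store k x y) s (s.setArr k (s.reg x) (s.reg y)) 1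
  | write (x : ℕ) (s : Store) : Exec (.write x) s { s with out := s.out ++ [s.reg x] } 1
  | seq {c d : Program} {s s' s'' : Store} {t t' : ℕ} (h : Exec c s s' t) (h' : Exec d s' s'' t') :
      Exec (.seq c d) s s'' (t + t')
  | cond_true {x : ℕ} {c d : Program} {s s' : Store} {t : ℕ} (hx : s.reg x ≠ 0)
      (h : Exec c s s' t) : Exec (.cond x c d) s s' (t + 1)
  | cond_false {x : ℕ} {c d : Program} {s s' : Store} {t : ℕ} (hx : s.reg x = 0)
      (h : Exec d s s' t) : Exec (.cond x c d) s s' (t + 1)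
  | loop_done {x : ℕ} {c : Program} {s : Store} (hx : s.reg x = 0) : Exec (.loop x c) s s 1
  | loop_step {x : ℕ} {c : Program} {s s' s'' : Store} {t t' : ℕ} (hx : s.reg x ≠ 0)
      (h : Exec c s s' t) (h' : Exec (.loop x c) s' s'' t') : Exec (.loop x c) s s'' (t + t' + 1)

/-- The initial configuration: the input is in the array `A_0`, its length in the register
`R[0]`, everything else is zero, and the output tape is empty. -/
def Store.init (input : List ℕ) : Store where
  reg x := if x = 0 then input.length else 0
  arr k i := if k = 0 then input.getD i 0 else 0
  out := []

/-- The program `c`, started on `input`, halts after `t` steps and has then written `output`. -/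
def Program.Computes (c : Program) (input output : List ℕ) (t : ℕ) : Prop :=
  ∃ s : Store, Exec c (Store.init input) s t ∧ s.out = output

/-! ### Encodings -/

open Classical in
/-- The matrix (rows one after the other) of a relation, with entries `0` and `1`. -/
noncomputable def encodeRel {m n : ℕ} (r : Fin m → Fin n → Prop) : List ℕ :=
  (List.finRange m).flatMap fun i => (List.finRange n).map fun j => if r i j then 1 else 0

/-- A graph is encoded by its number of vertices, followed by its adjacency matrix. -/
noncomputable def encodeGraph {n : ℕ} (G : SimpleGraph (Fin n)) : List ℕ :=
  n :: encodeRel G.Adj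

/-- A graph with a tree decomposition is encoded by the code of the graph, followed by the code of
the tree and by the incidence matrix of the nodes of the tree and the vertices in their bags. -/
noncomputable def encodeInput {n m : ℕ} (G : SimpleGraph (Fin n))
    (D : TreeDecomposition G (Fin m)) : List ℕ :=
  encodeGraph G ++ encodeGraph D.tree ++ encodeRel fun i a => a ∈ D.bag i

end GraphExpansion

/-! Replace every node of the given tree by a path with so many slots that each possible tree edge
at the node and each pair `a < b` of vertices of `G` has a slot of its own: the edge to node `j`
leaves from slot `j < m`, and the pair `a < b` owns slot `m + a * n + b`. The result is again a tree
(`IsTree.pathBlowup`), each path carrying the bag of its node. The vertices of the expansion are the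
pairs of a vertex `a` and a node of this tree whose bag contains `a`. The copies of `a` are joined
along the tree, and an edge `a b` of `G` is realised once, at its own slot in the first bag
containing both ends.

Projecting to `G`, the fibres are trees and each edge of `G` has exactly one lift. Such an `H` is an
expansion (`IsExpansion.of_isTree_fibres`), because contracting a leaf of a fibre into its parent
undoes a splitting. A copy has at most two neighbours on its path and at most one through its slot,
so the degree is at most three (`isTernary_expansion`).

For the width, walk from a tree node to its parent and exchange the copies of the vertices one at a
time. Only the vertex being exchanged occurs twice, so bags grow by at most one
(`exists_treeDecomposition_treeExpansion`).

For the running time, adjacency in the expansion is a bounded arithmetic formula in the input whose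
quantifiers range below the input length. A small language of such expressions compiles to machine
programs with a polynomial cost fixed by the expression (`ListExpr.computes`), and
`eval_expansionCode` identifies the value of one such expression with the code of the expansion. -/

namespace SimpleGraph

/-! ### Rooted trees and the blow-up of nodes into paths. -/

/-- `T` is the tree with root `r` in which `p x` is the parent of `x ≠ r`; the function `d`
decreases from a vertex to its parent. -/
def IsRooted {ι : Type*} (T : SimpleGraph ι) (r : ι) (p : ι → ι) (d : ι → ℕ) : Prop :=
  (∀ x, x ≠ r → d (p x) < d x) ∧
    ∀ x y, T.Adj x y ↔ (x ≠ r ∧ p x = y) ∨ (y ≠ r ∧ p y = x)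

variable {ι : Type*} {T : SimpleGraph ι} {r : ι} {p : ι → ι} {d : ι → ℕ}

lemma IsRooted.adj_parent (h : T.IsRooted r p d) {x : ι} (hx : x ≠ r) : T.Adj x (p x) :=
  (h.2 _ _).2 (Or.inl ⟨hx, rfl⟩)

lemma IsRooted.connected (h : T.IsRooted r p d) : T.Connected := by
  have key : ∀ k x, d x = k → T.Reachable x r := by
    intro k
    induction k using Nat.strong_induction_on with
    | _ k ih =>
      intro x hx
      by_cases hr : x = r
      · rw [hr]
      · exact (h.adj_parent hr).reachable.trans (ih _ (hx ▸ h.1 x hr) _ rfl)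
  have : Nonempty ι := ⟨r⟩
  exact ⟨fun x y => (key _ x rfl).trans (key _ y rfl).symm⟩

/-- Edges correspond to non-root vertices via `x ↦ {x, p x}`. Injectivity uses that two vertices
cannot be each other's parents, since `d` decreases. A connected graph with one edge fewer than
vertices is a tree. -/
lemma IsRooted.isTree [Finite ι] (h : T.IsRooted r p d) : T.IsTree := by
  classical
  rw [isTree_iff_connected_and_card]
  refine ⟨h.connected, ?_⟩
  let f : {x // x ≠ r} → T.edgeSet := fun x => ⟨s(x.1, p x.1), h.adj_parent x.2⟩
  have hf : Function.Bijective f := by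
    constructor
    · rintro ⟨x, hx⟩ ⟨y, hy⟩ hxy
      have : s(x, p x) = s(y, p y) := congrArg Subtype.val hxy
      rw [Sym2.eq_iff] at this
      rcases this with h1 | h1
      · exact Subtype.ext h1.1
      · have h2 := h.1 x hx
        have h3 := h.1 y hy
        rw [h1.2] at h2
        rw [← h1.1] at h3
        omega
    · rintro ⟨e, he⟩
      induction e using Sym2.ind with
      | _ x y =>
        rcases (h.2 x y).1 he with ⟨hx, rfl⟩ | ⟨hy, rfl⟩
        · exact ⟨⟨x, hx⟩, rfl⟩
        · exact ⟨⟨y, hy⟩, Subtype.ext Sym2.eq_swap⟩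
  rw [← Nat.card_congr (Equiv.ofBijective f hf), ← Finite.card_option,
    Nat.card_congr (Equiv.optionSubtypeNe r)]

/-- Take `d` to be the distance from `r`. Two neighbours of `x` closer to `r` would give two paths
from `r` to `x`, and in a tree every edge changes the distance by exactly one. -/
lemma IsTree.exists_isRooted (h : T.IsTree) (r : ι) : ∃ p d, T.IsRooted r p d := by
  have uniq : ∀ x y z, T.Adj y x → T.Adj z x → T.dist r x = T.dist r y + 1 →
      T.dist r x = T.dist r z + 1 → y = z := by
    intro x y z hy hz hdy hdz
    obtain ⟨q, hq⟩ := h.connected.exists_walk_length_eq_dist r y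
    obtain ⟨q', hq'⟩ := h.connected.exists_walk_length_eq_dist r z
    have h1 : (q.concat hy).IsPath := Walk.isPath_of_length_eq_dist _ (by simp [hq, hdy])
    have h2 : (q'.concat hz).IsPath := Walk.isPath_of_length_eq_dist _ (by simp [hq', hdz])
    have := (h.isAcyclic.subsingleton_path r x).elim ⟨_, h1⟩ ⟨_, h2⟩
    have := congrArg (fun w : T.Path r x => w.1.penultimate) this
    simpa using this
  have ex : ∀ x, ∃ y, x ≠ r → T.Adj y x ∧ T.dist r x = T.dist r y + 1 := by
    intro x
    by_cases hx : x = r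
    · exact ⟨x, fun h => absurd hx h⟩
    · obtain ⟨q, hq⟩ := h.connected.exists_walk_length_eq_dist x r
      cases q with
      | nil => exact absurd rfl hx
      | cons e q =>
        rename_i y
        refine ⟨y, fun _ => ⟨e.symm, ?_⟩⟩
        have h1 := dist_le q
        rw [Walk.length_cons] at hq
        rw [dist_comm, dist_comm (u := r)]
        rcases h.dist_eq_dist_add_one_of_adj r e with h2 | h2 <;>
          rw [dist_comm, dist_comm (u := r)] at h2 <;> omega
  choose p hp using ex
  refine ⟨p, T.dist r, fun x hx => by have := (hp x hx).2; omega, fun x y => ⟨fun e => ?_, ?_⟩⟩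
  · rcases h.dist_eq_dist_add_one_of_adj r e with h2 | h2
    · have hx : x ≠ r := by rintro rfl; simp at h2
      exact Or.inl ⟨hx, uniq _ _ _ (hp x hx).1 e.symm (hp x hx).2 h2⟩
    · have hx : y ≠ r := by rintro rfl; simp at h2
      exact Or.inr ⟨hx, uniq _ _ _ (hp y hx).1 e (hp y hx).2 h2⟩
  · rintro (⟨hx, rfl⟩ | ⟨hy, rfl⟩)
    · exact (hp x hx).1.symm
    · exact (hp y hy).1

/-- The graph obtained from `T` by replacing every vertex `i` by a path with vertices
`(i, 0), (i, 1), …`, where the edge `i j` of `T` connects `(i, port j)` and `(j, port i)`. -/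
def pathBlowup (T : SimpleGraph ι) {K : ℕ} (port : ι → Fin K) : SimpleGraph (ι × Fin K) where
  Adj x y := (x.1 = y.1 ∧ (x.2.val + 1 = y.2 ∨ y.2.val + 1 = x.2)) ∨
    (T.Adj x.1 y.1 ∧ x.2 = port y.1 ∧ y.2 = port x.1)
  symm := ⟨by
    rintro x y (⟨h, h'⟩ | ⟨h, h', h''⟩)
    · exact Or.inl ⟨h.symm, h'.symm⟩
    · exact Or.inr ⟨h.symm, h'', h'⟩⟩
  loopless := ⟨by
    rintro x (⟨h, h'⟩ | ⟨h, h', h''⟩)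
    · omega
    · exact T.irrefl h⟩

lemma IsTree.pathBlowup [Finite ι] (h : T.IsTree) {K : ℕ} (port : ι → Fin K) :
    (T.pathBlowup port).IsTree := by
  obtain ⟨r⟩ := h.connected.nonempty
  obtain ⟨p, d, hd, hp⟩ := h.exists_isRooted r
  -- The parent map walks along the path of a node to the slot facing the parent node, then crosses
  -- over.
  let q : ι × Fin K → ι × Fin K := fun x =>
    if h1 : x.2 < port (p x.1) then (x.1, ⟨x.2 + 1, by omega⟩)
    else if h2 : port (p x.1) < x.2 then (x.1, ⟨x.2 - 1, by omega⟩)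
    else (p x.1, port x.1)
  -- The natural subtractions add up to the distance to that slot; it is less than `K + 1`, so
  -- crossing to the parent node always wins.
  let e : ι × Fin K → ℕ := fun x =>
    d x.1 * (K + 1) + ((x.2 - port (p x.1) : ℕ) + (port (p x.1) - x.2 : ℕ))
  have hq1 : ∀ i s, s < port (p i) → ((q (i, s)).1 = i ∧ ((q (i, s)).2 : ℕ) = s + 1) := by
    intro i s h1
    simp [q, h1]
  have hq2 : ∀ i s, port (p i) < s → ((q (i, s)).1 = i ∧ ((q (i, s)).2 : ℕ) = s - 1) := by
    intro i s h1
    simp [q, h1, not_lt_of_gt h1]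
  have hq3 : ∀ i, q (i, port (p i)) = (p i, port i) := by
    intro i
    simp [q]
  -- The value `p r` has no meaning here. It merely selects some slot of the root path as the root.
  refine (show (T.pathBlowup port).IsRooted (r, port (p r)) q e from ⟨?_, ?_⟩).isTree
  · rintro ⟨i, s⟩ hne
    rcases lt_trichotomy s (port (p i)) with h1 | h1 | h1
    · obtain ⟨h2, h3⟩ := hq1 i s h1
      simp only [e, h2, h3]
      have : (s : ℕ) < port (p i) := h1
      omega
    · subst h1
      have hi : i ≠ r := by rintro rfl; exact hne rfl
      have h2 := hd i hi
      simp only [e, hq3]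
      have h3 : (d (p i) + 1) * (K + 1) ≤ d i * (K + 1) := Nat.mul_le_mul_right _ h2
      have := (port i).2
      have := (port (p (p i))).2
      rw [add_mul] at h3
      omega
    · obtain ⟨h2, h3⟩ := hq2 i s h1
      simp only [e, h2, h3]
      have : (port (p i) : ℕ) < s := h1
      omega
  · have one : ∀ x, x ≠ (r, port (p r)) → (T.pathBlowup port).Adj x (q x) := by
      rintro ⟨i, s⟩ hne
      rcases lt_trichotomy s (port (p i)) with h1 | h1 | h1
      · obtain ⟨h2, h3⟩ := hq1 i s h1
        exact Or.inl ⟨h2.symm, Or.inl h3.symm⟩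
      · subst h1
        have hi : i ≠ r := by rintro rfl; exact hne rfl
        rw [hq3]
        exact Or.inr ⟨(hp _ _).2 (Or.inl ⟨hi, rfl⟩), rfl, rfl⟩
      · obtain ⟨h2, h3⟩ := hq2 i s h1
        have : (port (p i) : ℕ) < s := h1
        refine Or.inl ⟨h2.symm, Or.inr ?_⟩
        simp only [h3]
        omega
    have step : ∀ x y : ι × Fin K, x.1 = y.1 → x.2.val + 1 = y.2 →
        (x ≠ (r, port (p r)) ∧ q x = y) ∨ (y ≠ (r, port (p r)) ∧ q y = x) := by
      rintro ⟨i, s⟩ ⟨j, t⟩ (rfl : i = j) (hst : s.val + 1 = t)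
      by_cases h1 : s < port (p i)
      · obtain ⟨h2, h3⟩ := hq1 i s h1
        refine Or.inl ⟨fun h => ?_, Prod.ext h2 (Fin.ext (h3.trans hst))⟩
        rw [Prod.mk.injEq] at h
        obtain ⟨rfl, rfl⟩ := h
        exact lt_irrefl _ h1
      · have h1' : port (p i) < t := by
          rw [Fin.lt_def] at h1 ⊢; omega
        obtain ⟨h2, h3⟩ := hq2 i t h1'
        refine Or.inr ⟨fun h => ?_, Prod.ext h2 (Fin.ext (h3.trans ?_))⟩
        · rw [Prod.mk.injEq] at h
          obtain ⟨rfl, rfl⟩ := h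
          exact lt_irrefl _ h1'
        · simp only; omega
    intro x y
    constructor
    · rintro (⟨h1, h2 | h2⟩ | ⟨h1, h2, h3⟩)
      · exact step x y h1 h2
      · exact (step y x h1.symm h2).symm
      · obtain ⟨i, s⟩ := x
        obtain ⟨j, t⟩ := y
        simp only at h1 h2 h3
        subst h2 h3
        rcases (hp _ _).1 h1 with ⟨h2, rfl⟩ | ⟨h2, rfl⟩
        · exact Or.inl ⟨fun h => h2 (Prod.mk.inj h).1, hq3 i⟩
        · exact Or.inr ⟨fun h => h2 (Prod.mk.inj h).1, hq3 j⟩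
    · rintro (⟨h1, rfl⟩ | ⟨h1, rfl⟩)
      · exact one x h1
      · exact (one y h1).symm

/-- Blowing up commutes with passing to an induced subgraph. -/
def pathBlowupInduceIso (T : SimpleGraph ι) {K : ℕ} (port : ι → Fin K) (S : Set ι) :
    (T.induce S).pathBlowup (fun i => port i) ≃g
      (T.pathBlowup port).induce {x | x.1 ∈ S} where
  toFun x := ⟨(x.1.1, x.2), x.1.2⟩
  invFun x := (⟨x.1.1, x.2⟩, x.1.2)
  left_inv _ := rfl
  right_inv _ := rfl
  map_rel_iff' := by
    rintro ⟨⟨i, hi⟩, s⟩ ⟨⟨j, hj⟩, t⟩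
    simp [pathBlowup]

end SimpleGraph

/-! ### Contracting tree fibres to reverse splittings. -/

namespace GraphExpansion

open SimpleGraph

/-- Contracting a forest of rooted trees: `H` is an expansion of `G` if the fibres of `f` are the
rooted trees described by `root`, `p` and `d`, and every edge of `G` corresponds to exactly one
edge of `H` between different fibres. -/
lemma IsExpansion.of_rooted_fibres {V : Type u} {G : SimpleGraph V} (k : ℕ) :
    ∀ {W : Type v} [Finite W] {H : SimpleGraph W} (f : W → V) (root : V → W) (p : W → W)
      (d : W → ℕ), Nat.card W = k → (∀ a, f (root a) = a) →
      (∀ x, x ≠ root (f x) → f (p x) = f x ∧ d (p x) < d x) →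
      (∀ x y, f x = f y → (H.Adj x y ↔ (x ≠ root (f x) ∧ p x = y) ∨ (y ≠ root (f y) ∧ p y = x))) →
      (∀ x y, H.Adj x y → f x ≠ f y → G.Adj (f x) (f y)) →
      (∀ a b, G.Adj a b → ∃ x y, f x = a ∧ f y = b ∧ H.Adj x y) →
      (∀ x y x' y', H.Adj x y → H.Adj x' y' → f x ≠ f y → f x = f x' → f y = f y' →
        x = x' ∧ y = y') →
      IsExpansion G H := by
  classical
  induction k with
  | zero =>
    intro W _ H f root p d hk hroot _ _ _ _ _
    have hW : IsEmpty W := by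
      rcases Nat.card_eq_zero.1 hk with h | h
      · exact h
      · exact absurd ‹Finite W› (not_finite_iff_infinite.2 h)
    -- Since `root : V → W`, an empty `W` forces `V` to be empty.
    exact .iso ⟨⟨root, f, hroot, fun x => hW.elim x⟩, fun {a} => hW.elim (root a)⟩
  | succ k ih =>
    intro W _ H f root p d hk hroot hp ha h1 h2 h3
    by_cases hex : ∃ x, x ≠ root (f x)
    · obtain ⟨x, hx, hmax⟩ := Set.exists_max_image {x | x ≠ root (f x)} d (Set.toFinite _) hex
      have hx : x ≠ root (f x) := hx
      have hxy : p x ≠ x := fun h => by have := (hp x hx).2; rw [h] at this; omega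
      have hadj : H.Adj x (p x) := (ha _ _ (hp x hx).1.symm).2 (Or.inl ⟨hx, rfl⟩)
      have hleaf : ∀ z, f z = f x → H.Adj x z → z = p x := by
        intro z hz hxz
        rcases (ha _ _ hz.symm).1 hxz with h | h
        · exact h.2.symm
        · have h4 := (hp z h.1).2
          have h5 := hmax z h.1
          rw [h.2] at h4
          omega
      let y : {w // w ≠ x} := ⟨p x, hxy⟩
      let π : W → {w // w ≠ x} := fun w => if h : w = x then y else ⟨w, h⟩
      have hπx : π x = y := by simp [π]
      have hπ : ∀ w : {w // w ≠ x}, π w = w := fun w => by simp [π, w.2]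
      have hπ' : ∀ w, w ≠ x → (π w : W) = w := fun w hw => by simp [π, hw]
      have hfπ : ∀ w, f (π w) = f w := by
        intro w
        by_cases h : w = x
        · rw [h, hπx]; exact (hp x hx).1
        · rw [hπ' w h]
      have hπc : ∀ w, (w = x ∧ π w = y) ∨ (w ≠ x ∧ (π w : W) = w) := by
        intro w
        by_cases h : w = x
        · exact Or.inl ⟨h, h ▸ hπx⟩
        · exact Or.inr ⟨h, hπ' w h⟩
      -- The quotient of `H` by the contraction of `x` into its parent `y`. It satisfies the
      -- hypotheses again with one vertex fewer.
      let H₁ : SimpleGraph {w // w ≠ x} :=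
        { Adj := fun w w' => w ≠ w' ∧ ∃ u u', π u = w ∧ π u' = w' ∧ H.Adj u u'
          symm := ⟨by
            rintro w w' ⟨h, u, u', hu, hu', e⟩
            exact ⟨h.symm, u', u, hu', hu, e.symm⟩⟩
          loopless := ⟨fun w h => h.1 rfl⟩ }
      have hfibre : ∀ w w' : {w // w ≠ x}, f w = f w' → (H₁.Adj w w' ↔ H.Adj w w') := by
        intro w w' hf
        constructor
        · rintro ⟨hne, u, u', rfl, rfl, e⟩
          rw [hfπ, hfπ] at hf
          rcases hπc u with ⟨rfl, hu⟩ | ⟨hu, hu'⟩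
          · exact absurd (by rw [hu, hleaf u' hf.symm e]; exact (hπ y).symm) hne
          · rcases hπc u' with ⟨rfl, hv⟩ | ⟨hv, hv'⟩
            · exact absurd (by rw [hv, hleaf u hf e.symm]; exact hπ y) hne
            · rwa [hu', hv']
        · intro e
          exact ⟨fun h => e.ne (congrArg _ h), w, w', hπ w, hπ w', e⟩
      have hrx : ∀ a, root a ≠ x := fun a h => hx (by rw [← h, hroot])
      have hpx : ∀ w, w ≠ root (f w) → p w ≠ x := by
        intro w hw h
        have h4 := (hp w hw).2
        have h5 := hmax w hw
        rw [h] at h4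
        omega
      have hcard : Nat.card {w // w ≠ x} = k := by
        have := Nat.card_congr (Equiv.optionSubtypeNe x)
        rw [Finite.card_option] at this
        omega
      have hsub : ∀ w : {w // w ≠ x}, w ≠ ⟨root (f w), hrx _⟩ → (w : W) ≠ root (f w) :=
        fun w h h' => h (Subtype.ext h')
      have hsub' : ∀ w : {w // w ≠ x}, (w : W) ≠ root (f w) → w ≠ ⟨root (f w), hrx _⟩ :=
        fun w h h' => h (congrArg Subtype.val h')
      have hpp : ∀ w : {w // w ≠ x}, (w : W) ≠ root (f w) → (π (p w) : W) = p w :=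
        fun w h => hπ' _ (hpx w h)
      have hexp : IsExpansion G H₁ := by
        refine ih (fun w => f w) (fun a => ⟨root a, hrx a⟩) (fun w => π (p w)) (fun w => d w) hcard
          hroot ?_ ?_ ?_ ?_ ?_
        · intro w hw
          have hw' := hsub w hw
          simp only [hpp w hw']
          exact hp w hw'
        · intro w w' hf
          rw [hfibre w w' hf, ha _ _ hf]
          refine or_congr ⟨fun h => ⟨hsub' _ h.1, Subtype.ext ?_⟩, fun h => ⟨hsub _ h.1, ?_⟩⟩
            ⟨fun h => ⟨hsub' _ h.1, Subtype.ext ?_⟩, fun h => ⟨hsub _ h.1, ?_⟩⟩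
          · rw [hpp _ h.1, h.2]
          · rw [← hpp _ (hsub _ h.1), h.2]
          · rw [hpp _ h.1, h.2]
          · rw [← hpp _ (hsub _ h.1), h.2]
        · rintro w w' ⟨-, u, u', rfl, rfl, e⟩ hf
          simp only [hfπ] at hf ⊢
          exact h1 u u' e hf
        · intro a b hab
          obtain ⟨u, u', rfl, rfl, e⟩ := h2 a b hab
          refine ⟨π u, π u', hfπ u, hfπ u', fun h => ?_, u, u', rfl, rfl, e⟩
          have := congrArg (fun w : {w // w ≠ x} => f w) h
          simp only [hfπ] at this
          exact hab.ne this
        · rintro w z w' z' ⟨-, u, v, rfl, rfl, e⟩ ⟨-, u', v', rfl, rfl, e'⟩ hf hf1 hf2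
          simp only [hfπ] at hf hf1 hf2
          obtain ⟨rfl, rfl⟩ := h3 _ _ _ _ e e' hf hf1 hf2
          exact ⟨rfl, rfl⟩
      -- Apart from `y`, neighbours of `x` lie in other fibres. A common neighbour of `x` and `y`
      -- would be reached by two edges between the same pair of fibres. Without this, the
      -- contraction would merge edges and could not be undone by a splitting.
      have hS : ∀ w : {w // w ≠ x}, H.Adj x w → w ≠ y → ¬ H.Adj y w := by
        intro w hw hwy hyw
        have hf : f x ≠ f w := fun h => hwy (Subtype.ext (hleaf w h.symm hw))
        exact hxy (h3 _ _ _ _ hw hyw hf (hp x hx).1.symm rfl).1.symm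
      -- `H` is recovered by splitting `y`, with `x` as the new vertex and its remaining neighbours
      -- as the support.
      refine hexp.split y {w | w ≠ y ∧ H.Adj x w} ?_ ⟨Equiv.optionSubtypeNe x, ?_⟩
      · rintro w ⟨hwy, hw⟩
        exact ⟨hwy.symm, x, w, hπx, hπ w, hw⟩
      · rintro (_ | w) (_ | w')
        · simp [splitting]
        · simp only [Equiv.optionSubtypeNe_none, Equiv.optionSubtypeNe_some, splitting,
            Set.mem_ofPred_eq]
          by_cases h : w' = y
          · simp [h, y, hadj]
          · simp [h]
        · simp only [Equiv.optionSubtypeNe_none, Equiv.optionSubtypeNe_some, splitting,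
            Set.mem_ofPred_eq]
          by_cases h : w = y
          · simp [h, y, hadj.symm]
          · simp [h, H.adj_comm]
        · simp only [Equiv.optionSubtypeNe_some, splitting, Set.mem_ofPred_eq]
          constructor
          · intro e
            refine ⟨⟨fun h => e.ne (congrArg _ h), w, w', hπ w, hπ w', e⟩, ?_, ?_⟩
            · rintro ⟨rfl, h, h'⟩
              exact hS _ h' h e
            · rintro ⟨rfl, h, h'⟩
              exact hS _ h' h e.symm
          · rintro ⟨⟨hne, u, u', rfl, rfl, e⟩, h4, h5⟩
            rcases hπc u with ⟨rfl, hu⟩ | ⟨hu, hu'⟩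
            · rcases hπc u' with ⟨rfl, hv⟩ | ⟨hv, hv'⟩
              · exact absurd e (H.irrefl)
              · exact absurd ⟨hu, fun h => hne (hu.trans h.symm), by rwa [hv']⟩ h4
            · rcases hπc u' with ⟨rfl, hv⟩ | ⟨hv, hv'⟩
              · exact absurd ⟨hv, fun h => hne (h.trans hv.symm), by rw [hu']; exact e.symm⟩ h5
              · rwa [hu', hv']
    · push Not at hex
      refine .iso ⟨⟨root, f, hroot, fun x => (hex x).symm⟩, fun {a b} => ?_⟩
      change H.Adj (root a) (root b) ↔ G.Adj a b
      constructor
      · intro e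
        have := h1 _ _ e (fun h => e.ne (by rw [hex (root a), h, ← hex]))
        rwa [hroot, hroot] at this
      · intro e
        obtain ⟨x, y, rfl, rfl, e'⟩ := h2 a b e
        rwa [← hex, ← hex]

/-- `H` is an expansion of `G` if `f` maps `H` to `G` in such a way that the fibres are trees and
every edge of `G` corresponds to exactly one edge of `H` between different fibres. -/
theorem IsExpansion.of_isTree_fibres {V : Type u} {G : SimpleGraph V} {W : Type v} [Finite W]
    {H : SimpleGraph W} (f : W → V) (hf : ∀ a, (H.induce {x | f x = a}).IsTree)
    (h1 : ∀ x y, H.Adj x y → f x ≠ f y → G.Adj (f x) (f y))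
    (h2 : ∀ a b, G.Adj a b → ∃ x y, f x = a ∧ f y = b ∧ H.Adj x y)
    (h3 : ∀ x y x' y', H.Adj x y → H.Adj x' y' → f x ≠ f y → f x = f x' → f y = f y' →
      x = x' ∧ y = y') : IsExpansion G H := by
  have hr : ∀ a, ∃ r p d, (H.induce {x | f x = a}).IsRooted r p d := fun a => by
    obtain ⟨r⟩ := (hf a).connected.nonempty
    exact ⟨r, (hf a).exists_isRooted r⟩
  choose r p d hd hp using hr
  -- The data chosen for each fibre depend on the base point; these two identities compare them
  -- along an equality `f z = a`.
  have hd' : ∀ a z (h : f z = a), d (f z) ⟨z, rfl⟩ = d a ⟨z, h⟩ := by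
    rintro a z rfl
    rfl
  have hp' : ∀ a z (h : f z = a), (p (f z) ⟨z, rfl⟩ : W) = p a ⟨z, h⟩ := by
    rintro a z rfl
    rfl
  have hne : ∀ x, x ≠ (r (f x) : W) ↔ (⟨x, rfl⟩ : {z // f z = f x}) ≠ r (f x) := fun x =>
    not_congr ⟨fun h => Subtype.ext h, fun h => congrArg Subtype.val h⟩
  refine IsExpansion.of_rooted_fibres _ f (fun a => r a) (fun x => p (f x) ⟨x, rfl⟩)
    (fun x => d (f x) ⟨x, rfl⟩) rfl (fun a => (r a).2) ?_ ?_ h1 h2 h3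
  · intro x hx
    have h4 : f (p (f x) ⟨x, rfl⟩) = f x := (p (f x) ⟨x, rfl⟩).2
    refine ⟨h4, ?_⟩
    rw [hd' (f x) _ h4]
    exact hd (f x) ⟨x, rfl⟩ ((hne x).1 hx)
  · intro x y hxy
    have := hp (f y) ⟨x, hxy⟩ ⟨y, rfl⟩
    rw [hp' (f y) x hxy, hxy]
    simp only [comap_adj, Function.Embedding.subtype_apply] at this
    rw [this]
    simp only [ne_eq, Subtype.ext_iff]

lemma IsExpansion.of_iso {V : Type u} {V' : Type*} {G : SimpleGraph V} {G' : SimpleGraph V'}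
    (e : G' ≃g G) {W : Type v} {H : SimpleGraph W} (h : IsExpansion G H) : IsExpansion G' H := by
  induction h with
  | iso e' => exact .iso (e.trans e')
  | split a S hS e' _ ih => exact ih.split a S hS e'

lemma IsExpansion.trans_iso {V : Type u} {G : SimpleGraph V} {W W' : Type v} {H : SimpleGraph W}
    {H' : SimpleGraph W'} (h : IsExpansion G H) (e : H ≃g H') : IsExpansion G H' := by
  cases h with
  | iso e' => exact .iso (e'.trans e)
  | split a S hS e' h => exact h.split a S hS (e'.trans e)

end GraphExpansion

/-! ### Trees from parent functions, and transport of tree decompositions. -/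

namespace SimpleGraph

/-- The tree given by a parent function. -/
def rootedTree {ι : Type*} (r : ι) (p : ι → ι) (d : ι → ℕ) (h : ∀ x, x ≠ r → d (p x) < d x) :
    SimpleGraph ι where
  Adj x y := (x ≠ r ∧ p x = y) ∨ (y ≠ r ∧ p y = x)
  symm := ⟨fun _ _ => Or.symm⟩
  loopless := ⟨fun x hx => by
    have hx' : x ≠ r ∧ p x = x := or_self_iff.1 hx
    have := h x hx'.1
    rw [hx'.2] at this
    omega⟩

lemma rootedTree_isRooted {ι : Type*} (r : ι) (p : ι → ι) (d : ι → ℕ)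
    (h : ∀ x, x ≠ r → d (p x) < d x) : (rootedTree r p d h).IsRooted r p d :=
  ⟨h, fun _ _ => Iff.rfl⟩

end SimpleGraph

namespace GraphExpansion

open SimpleGraph

/-- Transport of a tree decomposition along isomorphisms. -/
def TreeDecomposition.congr {V : Type*} {V' : Type*} {G : SimpleGraph V} {G' : SimpleGraph V'}
    {ι κ : Type*} (D : TreeDecomposition G ι) (e : G ≃g G') (f : ι ≃ κ) :
    TreeDecomposition G' κ where
  tree := D.tree.comap f.symm
  isTree := (Iso.isTree_iff (Iso.comap f.symm D.tree)).2 D.isTree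
  bag j := (D.bag (f.symm j)).map e.toEquiv.toEmbedding
  exists_mem_bag a := by
    obtain ⟨i, hi⟩ := D.exists_mem_bag (e.symm a)
    exact ⟨f i, Finset.mem_map.2 ⟨e.symm a, by simpa using hi, by simp⟩⟩
  exists_edge_bag a b h := by
    obtain ⟨i, hi, hi'⟩ := D.exists_edge_bag (e.symm a) (e.symm b) (e.symm.map_rel_iff.2 h)
    exact ⟨f i, Finset.mem_map.2 ⟨e.symm a, by simpa using hi, by simp⟩,
      Finset.mem_map.2 ⟨e.symm b, by simpa using hi', by simp⟩⟩
  connected a := by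
    have hmem : ∀ j, a ∈ (D.bag (f.symm j)).map e.toEquiv.toEmbedding ↔
        e.symm a ∈ D.bag (f.symm j) := by
      intro j
      rw [Finset.mem_map_equiv]
      rfl
    refine (Iso.connected_iff (?_ : D.tree.induce {i | e.symm a ∈ D.bag i} ≃g _)).1
      (D.connected (e.symm a))
    exact
      { toFun := fun i => ⟨f i.1, (hmem _).2 (by rw [f.symm_apply_apply]; exact i.2)⟩
        invFun := fun j => ⟨f.symm j.1, (hmem _).1 j.2⟩
        left_inv := fun i => by simp
        right_inv := fun j => by simp
        map_rel_iff' := by simp }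

lemma TreeDecomposition.card_bag_congr {V : Type*} {V' : Type*} {G : SimpleGraph V}
    {G' : SimpleGraph V'} {ι κ : Type*} (D : TreeDecomposition G ι) (e : G ≃g G') (f : ι ≃ κ)
    (j : κ) : ((D.congr e f).bag j).card = (D.bag (f.symm j)).card :=
  Finset.card_map _

lemma bddBelow_width {V : Type u} (G : SimpleGraph V) :
    BddBelow {k : ℤ | ∃ (m : ℕ) (D : TreeDecomposition G (Fin m)), D.width = k} := by
  refine ⟨-1, ?_⟩
  rintro k ⟨m, D, rfl⟩
  simp only [TreeDecomposition.width]
  omega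

lemma treewidth_le {V : Type*} {V' : Type u} {G : SimpleGraph V} {G' : SimpleGraph V'}
    (e : G ≃g G') {ι : Type*} [Finite ι] (D : TreeDecomposition G ι) (w : ℕ)
    (h : ∀ i, (D.bag i).card ≤ w + 1) : treewidth G' ≤ w := by
  obtain ⟨m, ⟨f⟩⟩ := Finite.exists_equiv_fin ι
  refine (csInf_le (bddBelow_width G') ⟨m, D.congr e f, rfl⟩).trans ?_
  have : (Finset.univ.sup fun i => ((D.congr e f).bag i).card) ≤ w + 1 :=
    Finset.sup_le fun i _ => by rw [D.card_bag_congr]; exact h _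
  simp only [TreeDecomposition.width]
  omega

lemma TreeDecomposition.card_bag_le {V : Type*} {G : SimpleGraph V} {ι : Type*} [Fintype ι]
    (D : TreeDecomposition G ι) (i : ι) : ((D.bag i).card : ℤ) ≤ D.width + 1 := by
  have : (D.bag i).card ≤ Finset.univ.sup fun i => (D.bag i).card :=
    Finset.le_sup (f := fun i => (D.bag i).card) (Finset.mem_univ i)
  simp only [TreeDecomposition.width]
  omega

lemma exists_width_eq_treewidth {V : Type u} [Finite V] (G : SimpleGraph V) :
    ∃ (m : ℕ) (D : TreeDecomposition G (Fin m)), D.width = treewidth G := by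
  cases nonempty_fintype V
  refine Int.csInf_mem ?_ (bddBelow_width G)
  -- A single node whose bag is everything shows that the set of widths is nonempty, so its infimum
  -- is attained.
  refine ⟨_, 1, ⟨⊥, IsTree.of_subsingleton, fun _ => Finset.univ, fun a => ⟨0, by simp⟩,
    fun a b _ => ⟨0, by simp, by simp⟩, fun a => ?_⟩, rfl⟩
  have : Nonempty {i : Fin 1 | a ∈ (Finset.univ : Finset V)} := ⟨⟨0, by simp⟩⟩
  exact IsTree.of_subsingleton.connected

/-! ### Expanding a graph along a tree, and the width of the result. -/

/-- The vertex `(a, t)` stands for the copy of `a` in the bag of `t`. The copies of a vertex are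
connected along the edges of `T`, and an edge `a b` of `G` connects the copies of `a` and `b` in
the node `t` that is related to `a` and `b` by `F`. -/
def treeExpansion {V : Type*} {ι : Type*} (G : SimpleGraph V) (T : SimpleGraph ι)
    (B : ι → Finset V) (F : V → V → ι → Prop) (hF : ∀ a b t, F a b t → F b a t) :
    SimpleGraph {x : V × ι // x.1 ∈ B x.2} where
  Adj x y := (x.1.1 = y.1.1 ∧ T.Adj x.1.2 y.1.2) ∨
    (x.1.2 = y.1.2 ∧ G.Adj x.1.1 y.1.1 ∧ F x.1.1 y.1.1 x.1.2)
  symm := ⟨by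
    rintro x y (⟨h, h'⟩ | ⟨h, h', h''⟩)
    · exact Or.inl ⟨h.symm, h'.symm⟩
    · exact Or.inr ⟨h.symm, h'.symm, h ▸ hF _ _ _ h''⟩⟩
  loopless := ⟨by
    rintro x (⟨h, h'⟩ | ⟨h, h', h''⟩)
    · exact T.irrefl h'
    · exact G.irrefl h'⟩

section

variable {V : Type*} {ι : Type*} {G : SimpleGraph V} {T : SimpleGraph ι}
  {B : ι → Finset V} {F : V → V → ι → Prop} {hF : ∀ a b t, F a b t → F b a t}

/-- The fibre over `a` is a copy of the subtree of nodes whose bag contains `a`, and the unique node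
related to `a` and `b` by `F` makes the lift of an edge unique. -/
lemma isExpansion_treeExpansion [Finite V] [Finite ι] (hT : ∀ a, (T.induce {t | a ∈ B t}).IsTree)
    (hex : ∀ a b, G.Adj a b → ∃ t, F a b t ∧ a ∈ B t ∧ b ∈ B t)
    (huniq : ∀ a b t t', G.Adj a b → F a b t → F a b t' → t = t') :
    IsExpansion G (treeExpansion G T B F hF) := by
  refine IsExpansion.of_isTree_fibres (fun x => x.1.1) (fun a => ?_) ?_ ?_ ?_
  · refine (Iso.isTree_iff (?_ : T.induce {t | a ∈ B t} ≃g _)).1 (hT a)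
    exact
      { toFun := fun t => ⟨⟨(a, t.1), t.2⟩, rfl⟩
        invFun := fun x => ⟨x.1.1.2, by
          obtain ⟨⟨⟨b, t⟩, h⟩, rfl⟩ := x
          exact h⟩
        left_inv := fun _ => rfl
        right_inv := by
          rintro ⟨⟨⟨b, t⟩, h⟩, rfl⟩
          rfl
        map_rel_iff' := by simp [treeExpansion] }
  · rintro x y (⟨h, h'⟩ | ⟨h, h', h''⟩) hne
    · exact absurd h hne
    · exact h'
  · intro a b hab
    obtain ⟨t, ht, ha, hb⟩ := hex a b hab
    exact ⟨⟨(a, t), ha⟩, ⟨(b, t), hb⟩, rfl, rfl, Or.inr ⟨rfl, hab, ht⟩⟩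
  · rintro ⟨⟨a, t⟩, ha⟩ ⟨⟨b, s⟩, hb⟩ ⟨⟨a', t'⟩, ha'⟩ ⟨⟨b', s'⟩, hb'⟩ h h' hne heq heq'
    dsimp only at hne heq heq'
    subst heq heq'
    rcases h with ⟨h, -⟩ | ⟨h, h1, h2⟩
    · exact absurd h hne
    · rcases h' with ⟨h', -⟩ | ⟨h', h1', h2'⟩
      · exact absurd h' hne
      · dsimp only at h h' h2 h2'
        subst h h'
        obtain rfl := huniq _ _ _ _ h1 h2 h2'
        exact ⟨rfl, rfl⟩

end

open Classical in
/-- The tree is obtained from `T` by subdividing every edge, and on the way from `t` to its parent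
the copies in `t` of the vertices are replaced one by one. -/
lemma exists_treeDecomposition_treeExpansion {n : ℕ} {ι : Type*} [Finite ι]
    {G : SimpleGraph (Fin n)} {T : SimpleGraph ι} {B : ι → Finset (Fin n)}
    {F : Fin n → Fin n → ι → Prop} {hF : ∀ a b t, F a b t → F b a t} (hT : T.IsTree) {w : ℕ}
    (hB : ∀ t, (B t).card ≤ w) :
    ∃ D : TreeDecomposition (treeExpansion G T B F hF) (ι × Fin (n + 1)),
      ∀ i, (D.bag i).card ≤ w + 1 := by
  cases nonempty_fintype ι
  obtain ⟨r⟩ := hT.connected.nonempty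
  obtain ⟨p, d, hd, hp⟩ := hT.exists_isRooted r
  -- The path `(t, 0), …, (t, n)` leads from `t` towards `(p t, 0)`. The path of `r` has nowhere to
  -- go, so its end becomes the root.
  let q : ι × Fin (n + 1) → ι × Fin (n + 1) := fun x =>
    if h : x.2.val < n then (x.1, ⟨x.2 + 1, by omega⟩) else (p x.1, 0)
  let e : ι × Fin (n + 1) → ℕ := fun x => d x.1 * (n + 2) + (n - x.2)
  have hq : ∀ t (k : Fin n), q (t, k.castSucc) = (t, k.succ) := by
    intro t k
    simp [q, Fin.succ]
  have hq' : ∀ t, q (t, Fin.last n) = (p t, 0) := by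
    intro t
    simp [q]
  have hqe : ∀ x, x ≠ (r, Fin.last n) → e (q x) < e x := by
    rintro ⟨t, k⟩ hne
    induction k using Fin.lastCases with
    | cast k =>
      rw [hq]
      simp only [e, Fin.val_succ, Fin.val_castSucc]
      omega
    | last =>
      rw [hq']
      have ht : t ≠ r := by rintro rfl; exact hne rfl
      have h3 : (d (p t) + 1) * (n + 2) ≤ d t * (n + 2) := Nat.mul_le_mul_right _ (hd t ht)
      rw [add_mul] at h3
      simp only [e, Fin.val_zero, Fin.val_last]
      omega
  let T' := rootedTree (r, Fin.last n) q e hqe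
  have hstep : ∀ t (k : Fin n), T'.Adj (t, k.castSucc) (t, k.succ) := by
    intro t k
    refine Or.inl ⟨fun h => ?_, hq t k⟩
    exact (Fin.castSucc_lt_last k).ne (Prod.mk.inj h).2
  have hlast : ∀ t, t ≠ r → T'.Adj (t, Fin.last n) (p t, 0) := fun t ht =>
    Or.inl ⟨fun h => ht (Prod.mk.inj h).1, hq' t⟩
  -- At stage `k`, vertices above `k` still use the copy in `t`, those below `k` use the copy in the
  -- parent, and `k` uses both. Vertices of `B t` missing from the parent are simply dropped.
  let P : ι → Fin n → {x : Fin n × ι // x.1 ∈ B x.2} → Prop := fun t k x =>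
    x.1.1 ∈ B t ∧ ((x.1.2 = t ∧ k ≤ x.1.1) ∨ (t ≠ r ∧ x.1.2 = p t ∧ x.1.1 ≤ k))
  let bag : ι × Fin (n + 1) → Finset {x : Fin n × ι // x.1 ∈ B x.2} := fun y =>
    Fin.cases (motive := fun _ => Finset {x : Fin n × ι // x.1 ∈ B x.2})
      (Finset.univ.filter fun x => x.1.2 = y.1) (fun k => Finset.univ.filter (P y.1 k)) y.2
  have hbag0 : ∀ t x, x ∈ bag (t, 0) ↔ x.1.2 = t := by
    intro t x
    simp [bag]
  have hbag1 : ∀ t (k : Fin n) x, x ∈ bag (t, k.succ) ↔ P t k x := by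
    intro t k x
    simp [bag]
  refine ⟨⟨T', (rootedTree_isRooted _ _ _ hqe).isTree, bag, ?_, ?_, ?_⟩, ?_⟩
  · exact fun x => ⟨(x.1.2, 0), (hbag0 _ _).2 rfl⟩
  · have key : ∀ x y : {x : Fin n × ι // x.1 ∈ B x.2}, x.1.1 = y.1.1 → x.1.2 ≠ r →
        p x.1.2 = y.1.2 → ∃ i, x ∈ bag i ∧ y ∈ bag i := by
      intro x y h h1 h2
      -- The two copies of a vertex meet at the stage in which that vertex is exchanged.
      refine ⟨(x.1.2, x.1.1.succ), (hbag1 _ _ _).2 ⟨x.2, Or.inl ⟨rfl, le_rfl⟩⟩,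
        (hbag1 _ _ _).2 ⟨h ▸ x.2, Or.inr ⟨h1, h2.symm, h.ge⟩⟩⟩
    rintro x y (⟨h, h'⟩ | ⟨h, -, -⟩)
    · rcases (hp _ _).1 h' with ⟨h1, h2⟩ | ⟨h1, h2⟩
      · exact key x y h h1 h2
      · obtain ⟨i, hi, hi'⟩ := key y x h.symm h1 h2
        exact ⟨i, hi', hi⟩
    · exact ⟨(x.1.2, 0), (hbag0 _ _).2 rfl, (hbag0 _ _).2 h.symm⟩
  · rintro ⟨⟨a, t₀⟩, ha⟩
    set x : {x : Fin n × ι // x.1 ∈ B x.2} := ⟨(a, t₀), ha⟩ with hx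
    let S : Set (ι × Fin (n + 1)) := {i | x ∈ bag i}
    have h0 : (t₀, 0) ∈ S := (hbag0 _ _).2 rfl
    -- The bags containing `x = (a, t₀)` are an initial run of the path of `t₀`, together with final
    -- runs on the paths of those children of `t₀` whose bag contains `a`. `down` and `up` connect
    -- both kinds to `(t₀, 0)`.
    have down : ∀ (k : Fin (n + 1)) (hk : (t₀, k) ∈ S),
        (T'.induce S).Reachable ⟨(t₀, k), hk⟩ ⟨(t₀, 0), h0⟩ := by
      intro k
      induction k using Fin.induction with
      | zero => exact fun _ => Reachable.rfl
      | succ k ih =>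
        intro hk
        have hk' : (t₀, k.castSucc) ∈ S := by
          obtain ⟨h1, h2⟩ := (hbag1 _ _ _).1 hk
          have hle : k ≤ a := by
            rcases h2 with h2 | ⟨h2, h3, h4⟩
            · exact h2.2
            · have : d (p t₀) < d t₀ := hd t₀ h2
              rw [← h3] at this
              exact absurd this (lt_irrefl _)
          rcases Nat.eq_zero_or_pos k.val with hk0 | hk0
          · have : k.castSucc = 0 := Fin.ext hk0
            rw [this]
            exact h0
          · have : k.castSucc = (⟨k - 1, by omega⟩ : Fin n).succ := Fin.ext (by simp; omega)
            rw [this]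
            refine (hbag1 _ _ _).2 ⟨h1, Or.inl ⟨rfl, ?_⟩⟩
            have : (k : ℕ) ≤ a := hle
            rw [Fin.le_def]
            simp only [hx]
            omega
        exact (show (T'.induce S).Adj ⟨(t₀, k.succ), hk⟩ ⟨(t₀, k.castSucc), hk'⟩ from
          (hstep t₀ k).symm).reachable.trans (ih hk')
    have up : ∀ (t : ι), t ≠ r → p t = t₀ → a ∈ B t → ∀ (k : Fin (n + 1)), a.succ ≤ k →
        ∀ (hk : (t, k) ∈ S), (T'.induce S).Reachable ⟨(t, k), hk⟩ ⟨(t₀, 0), h0⟩ := by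
      intro t ht hpt hat k
      induction k using Fin.reverseInduction with
      | last =>
        intro _ hk
        subst hpt
        exact (show (T'.induce S).Adj ⟨(t, Fin.last n), hk⟩ ⟨(p t, 0), h0⟩ from
          hlast t ht).reachable
      | cast k ih =>
        intro hak hk
        have hak' : a < k := by
          rw [Fin.le_def] at hak
          rw [Fin.lt_def]
          simpa using hak
        have hk' : (t, k.succ) ∈ S :=
          (hbag1 _ _ _).2 ⟨hat, Or.inr ⟨ht, hpt.symm, hak'.le⟩⟩
        exact (show (T'.induce S).Adj ⟨(t, k.castSucc), hk⟩ ⟨(t, k.succ), hk'⟩ from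
          hstep t k).reachable.trans (ih (Fin.succ_le_succ_iff.2 hak'.le) hk')
    have all : ∀ i : S, (T'.induce S).Reachable i ⟨(t₀, 0), h0⟩ := by
      rintro ⟨⟨t, k⟩, hi⟩
      by_cases ht : t = t₀
      · subst ht
        exact down k hi
      · induction k using Fin.cases with
        | zero => exact absurd ((hbag0 _ _).1 hi).symm ht
        | succ k =>
          obtain ⟨h1, h2⟩ := (hbag1 _ _ _).1 hi
          rcases h2 with h2 | ⟨h2, h3, h4⟩
          · exact absurd h2.1.symm ht
          · exact up t h2 h3.symm h1 k.succ (Fin.succ_le_succ_iff.2 h4) hi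
    have : Nonempty S := ⟨⟨_, h0⟩⟩
    exact ⟨fun i j => (all i).trans (all j).symm⟩
  · rintro ⟨t, k⟩
    change (bag (t, k)).card ≤ w + 1
    have inj : ∀ (s : Finset {x : Fin n × ι // x.1 ∈ B x.2}) (t : ι) (I : Finset (Fin n)),
        (∀ x ∈ s, x.1.2 = t ∧ x.1.1 ∈ I) → s.card ≤ I.card := by
      intro s t I h
      refine Finset.card_le_card_of_injOn (fun x => x.1.1) (fun x hx => (h x hx).2) ?_
      intro x hx y hy hxy
      exact Subtype.ext (Prod.ext hxy ((h x hx).1.trans (h y hy).1.symm))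
    induction k using Fin.cases with
    | zero =>
      refine (inj _ t (B t) fun x hx => ?_).trans ((hB t).trans (Nat.le_succ w))
      have := (hbag0 _ _).1 hx
      exact ⟨this, this ▸ x.2⟩
    | succ k =>
      have hsub : bag (t, k.succ) ⊆
          (Finset.univ.filter fun x => x.1.2 = t ∧ x.1.1 ∈ (B t).filter (k ≤ ·)) ∪
          (Finset.univ.filter fun x => x.1.2 = p t ∧ x.1.1 ∈ (B t).filter (· ≤ k)) := by
        intro x hx
        obtain ⟨h1, h2⟩ := (hbag1 _ _ _).1 hx
        rw [Finset.mem_union]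
        rcases h2 with h2 | h2
        · exact Or.inl (by simp [h1, h2])
        · exact Or.inr (by simp [h1, h2])
      refine (Finset.card_le_card hsub).trans ((Finset.card_union_le _ _).trans ?_)
      refine (Nat.add_le_add (inj _ t ((B t).filter (k ≤ ·)) fun x hx => (Finset.mem_filter.1 hx).2)
        (inj _ (p t) ((B t).filter (· ≤ k)) fun x hx => (Finset.mem_filter.1 hx).2)).trans ?_
      -- The parts of `B t` from `k` upwards and up to `k` overlap at most in `k`, which costs the
      -- single extra element.
      rw [← Finset.card_union_add_card_inter]
      refine Nat.add_le_add ((Finset.card_le_card ?_).trans (hB t)) (Finset.card_le_one.2 ?_)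
      · exact Finset.union_subset (Finset.filter_subset _ _) (Finset.filter_subset _ _)
      · intro a ha b hb
        simp only [Finset.mem_inter, Finset.mem_filter] at ha hb
        exact (le_antisymm ha.2.2 ha.1.2).trans (le_antisymm hb.2.2 hb.1.2).symm

lemma IsTernary.of_iso {V : Type*} {W : Type*} {G : SimpleGraph V} {H : SimpleGraph W}
    (e : G ≃g H) (h : IsTernary G) : IsTernary H := by
  intro a
  refine le_trans (le_of_eq ?_) (h (e.symm a))
  rw [← e.symm.toEquiv.injective.encard_image]
  congr 1
  ext b
  constructor
  · rintro ⟨c, hc, rfl⟩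
    exact e.symm.map_rel_iff.2 hc
  · intro hb
    refine ⟨e b, ?_, e.symm_apply_apply b⟩
    have := e.map_rel_iff.2 hb
    rwa [RelIso.apply_symm_apply] at this

/-! ### The ternary expansion belonging to a tree decomposition. -/

namespace TreeDecomposition

variable {n m : ℕ} {G : SimpleGraph (Fin n)} (D : TreeDecomposition G (Fin m))

/-- The node `i` is the first one whose bag contains `a` and `b`. -/
def IsFirst (a b : Fin n) (i : Fin m) : Prop :=
  (a ∈ D.bag i ∧ b ∈ D.bag i) ∧ ∀ k < i, ¬ (a ∈ D.bag k ∧ b ∈ D.bag k)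

/-- The node `x` of the tree in which every node of `D` is replaced by a path is the one in which
`a` and `b` are joined. -/
def IsMeeting (a b : Fin n) (x : Fin m × Fin (m + n * n)) : Prop :=
  D.IsFirst a b x.1 ∧
    ((a < b ∧ x.2.val = m + a * n + b) ∨ (b < a ∧ x.2.val = m + b * n + a))

variable {D} in
lemma IsFirst.symm {a b : Fin n} {i : Fin m} (h : D.IsFirst a b i) : D.IsFirst b a i :=
  ⟨h.1.symm, fun k hk h' => h.2 k hk h'.symm⟩

variable {D} in
lemma IsMeeting.symm {a b : Fin n} {x : Fin m × Fin (m + n * n)} (h : D.IsMeeting a b x) :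
    D.IsMeeting b a x :=
  ⟨h.1.symm, h.2.symm⟩

/-- The slot of the node `i` that is reserved for the edge to `j`. -/
def port (n : ℕ) {m : ℕ} (j : Fin m) : Fin (m + n * n) := Fin.castLE (Nat.le_add_right _ _) j

/-- The expansion of `G` read off from a tree decomposition of `G`. -/
def expansion : SimpleGraph {x : Fin n × (Fin m × Fin (m + n * n)) // x.1 ∈ D.bag x.2.1} :=
  treeExpansion G (D.tree.pathBlowup (port n)) (fun x => D.bag x.1) D.IsMeeting
    fun _ _ _ h => h.symm

lemma isTree_bag (a : Fin n) : (D.tree.induce {i | a ∈ D.bag i}).IsTree :=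
  ⟨D.connected a, D.isTree.isAcyclic.induce _⟩

lemma isExpansion_expansion : IsExpansion G D.expansion := by
  refine isExpansion_treeExpansion (fun a => ?_) ?_ ?_
  · exact (Iso.isTree_iff (pathBlowupInduceIso D.tree (port n) {i | a ∈ D.bag i})).1
      ((D.isTree_bag a).pathBlowup _)
  · have key : ∀ a b, G.Adj a b → a < b → ∃ t, D.IsMeeting a b t ∧ a ∈ D.bag t.1 ∧
        b ∈ D.bag t.1 := by
      intro a b hab hlt
      obtain ⟨i, hi, hmin⟩ := WellFounded.has_min (r := fun i j : Fin m => i < j)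
        wellFounded_lt {i | a ∈ D.bag i ∧ b ∈ D.bag i} (D.exists_edge_bag a b hab)
      have hi : a ∈ D.bag i ∧ b ∈ D.bag i := hi
      have h1 : a.val * n + b < n * n := by
        have h2 : (a.val + 1) * n ≤ n * n := Nat.mul_le_mul_right _ a.2
        rw [add_mul] at h2
        omega
      exact ⟨(i, ⟨m + a * n + b, by omega⟩), ⟨⟨hi, fun k hk h => hmin k h hk⟩,
        Or.inl ⟨hlt, rfl⟩⟩, hi⟩
    intro a b hab
    rcases lt_or_gt_of_ne hab.ne with h | h
    · exact key a b hab h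
    · obtain ⟨t, h1, h2, h3⟩ := key b a hab.symm h
      exact ⟨t, h1.symm, h3, h2⟩
  · intro a b t t' _ ht ht'
    refine Prod.ext ?_ (Fin.ext ?_)
    · rcases lt_trichotomy t.1 t'.1 with h | h | h
      · exact absurd ht.1.1 (ht'.1.2 _ h)
      · exact h
      · exact absurd ht'.1.1 (ht.1.2 _ h)
    · rcases ht.2 with h | h <;> rcases ht'.2 with h' | h'
      · exact h.2.trans h'.2.symm
      · exact absurd h.1 h'.1.asymm
      · exact absurd h.1 h'.1.asymm
      · exact h.2.trans h'.2.symm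

/-- Base `n` digits: the slot beyond the first `m` determines the ordered pair. -/
lemma slot_inj {a b a' b' : Fin n} (h : m + a.val * n + b = m + a' * n + b') :
    a = a' ∧ b = b' := by
  have h1 : finProdFinEquiv (a, b) = finProdFinEquiv (a', b') := by
    apply Fin.ext
    simp only [finProdFinEquiv_apply_val]
    rw [mul_comm n, mul_comm n]
    omega
  exact Prod.mk.inj (finProdFinEquiv.injective h1)

lemma isTernary_expansion : IsTernary D.expansion := by
  rintro ⟨⟨a, i, s⟩, ha⟩
  -- `U` and `L` hold the next and previous copy on the path, and `C` the neighbours through the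
  -- slot; each has at most one element.
  let X := {x : Fin n × (Fin m × Fin (m + n * n)) // x.1 ∈ D.bag x.2.1}
  let U : Set X := {y | a = y.1.1 ∧ i = y.1.2.1 ∧ s.val + 1 = y.1.2.2}
  let L : Set X := {y | a = y.1.1 ∧ i = y.1.2.1 ∧ y.1.2.2.val + 1 = s}
  let C : Set X := {y | (a = y.1.1 ∧ s = port n y.1.2.1 ∧ y.1.2.2 = port n i) ∨
    ((i, s) = y.1.2 ∧ D.IsMeeting a y.1.1 (i, s))}
  have hsub : D.expansion.neighborSet ⟨⟨a, i, s⟩, ha⟩ ⊆ U ∪ L ∪ C := by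
    rintro y (⟨h, (⟨h1, h2 | h2⟩ | ⟨h1, h2, h3⟩)⟩ | ⟨h, h1, h2⟩)
    · exact Or.inl (Or.inl ⟨h, h1, h2⟩)
    · exact Or.inl (Or.inr ⟨h, h1, h2⟩)
    · exact Or.inr (Or.inl ⟨h, h2, h3⟩)
    · exact Or.inr (Or.inr ⟨h, h2⟩)
  have hU : U.encard ≤ 1 := by
    rw [Set.encard_le_one_iff]
    rintro ⟨⟨b, j, t⟩, hb⟩ ⟨⟨b', j', t'⟩, hb'⟩ ⟨h1, h2, h3⟩ ⟨h1', h2', h3'⟩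
    dsimp only at h1 h2 h3 h1' h2' h3'
    obtain rfl : t = t' := Fin.ext (h3.symm.trans h3')
    subst h1 h2 h1' h2'
    rfl
  have hL : L.encard ≤ 1 := by
    rw [Set.encard_le_one_iff]
    rintro ⟨⟨b, j, t⟩, hb⟩ ⟨⟨b', j', t'⟩, hb'⟩ ⟨h1, h2, h3⟩ ⟨h1', h2', h3'⟩
    dsimp only at h1 h2 h3 h1' h2' h3'
    obtain rfl : t = t' := Fin.ext (by omega)
    subst h1 h2 h1' h2'
    rfl
  -- Tree edges use slots below `m` and edges of `G` slots from `m` on, so no slot serves both.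
  have hport : ∀ j b, s = port n j → ¬ D.IsMeeting a b (i, s) := by
    rintro j b rfl ⟨-, h⟩
    have := j.2
    simp only [port, Fin.val_castLE] at h
    omega
  have hC : C.encard ≤ 1 := by
    rw [Set.encard_le_one_iff]
    rintro ⟨⟨b, j, t⟩, hb⟩ ⟨⟨b', j', t'⟩, hb'⟩ (⟨h1, h2, h3⟩ | ⟨h1, h2⟩)
      (⟨h1', h2', h3'⟩ | ⟨h1', h2'⟩)
    · dsimp only at h1 h2 h3 h1' h2' h3'
      obtain rfl : j = j' := Fin.castLE_injective _ (h2.symm.trans h2')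
      subst h1 h3 h1' h3'
      rfl
    · exact absurd h2' (hport _ _ h2)
    · exact absurd h2 (hport _ _ h2')
    · dsimp only at h1 h2 h1' h2'
      obtain rfl : b = b' := by
        rcases h2.2 with h | h <;> rcases h2'.2 with h' | h'
        · exact (slot_inj (h.2.symm.trans h'.2)).2
        · obtain ⟨rfl, rfl⟩ := slot_inj (h.2.symm.trans h'.2)
          rfl
        · obtain ⟨rfl, rfl⟩ := slot_inj (h.2.symm.trans h'.2)
          rfl
        · exact (slot_inj (h.2.symm.trans h'.2)).1
      have h3 := h1.symm.trans h1'
      rw [Prod.mk.injEq] at h3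
      obtain ⟨rfl, rfl⟩ := h3
      rfl
  calc (D.expansion.neighborSet ⟨⟨a, i, s⟩, ha⟩).encard ≤ (U ∪ L ∪ C).encard :=
        Set.encard_le_encard hsub
    _ ≤ 1 + 1 + 1 := (Set.encard_union_le _ _).trans
        (add_le_add ((Set.encard_union_le _ _).trans (add_le_add hU hL)) hC)
    _ = 3 := by norm_num

lemma treewidth_le_of_iso {V : Type u} {H : SimpleGraph V} (e : D.expansion ≃g H) :
    treewidth H ≤ D.width + 1 := by
  obtain ⟨D', hD'⟩ := exists_treeDecomposition_treeExpansion (G := G) (F := D.IsMeeting)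
    (hF := fun _ _ _ h => h.symm) (D.isTree.pathBlowup (port n)) (B := fun x => D.bag x.1)
    (w := (D.width + 1).toNat) (fun t => by have := D.card_bag_le t.1; omega)
  refine (treewidth_le e D' _ hD').trans ?_
  -- The width is `-1` when all bags are empty, so `toNat` of the width plus one loses nothing.
  have : (-1 : ℤ) ≤ D.width := by
    simp only [width]
    omega
  omega

end TreeDecomposition

/-! ### A functional language that compiles to random access machines -/

lemma Store.reg_setReg_self (s : Store) (x val : ℕ) : (s.setReg x val).reg x = val := by
  simp [Store.setReg]

lemma Store.reg_setReg_of_ne (s : Store) {x y : ℕ} (val : ℕ) (h : y ≠ x) :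
    (s.setReg x val).reg y = s.reg y := by
  simp [Store.setReg, h]

lemma Store.out_setReg (s : Store) (x val : ℕ) : (s.setReg x val).out = s.out := rfl

namespace Program

/-- `R[x] := R[y]`, for `x ≠ y`. -/
def move (x y : ℕ) : Program := .seq (.const x 0) (.add x x y)

lemma exec_move {x y : ℕ} (h : y ≠ x) (s : Store) :
    Exec (move x y) s (s.setReg x (s.reg y)) 2 := by
  have := Exec.seq (Exec.const x 0 s) (Exec.add x x y (s.setReg x 0))
  rw [s.reg_setReg_self, s.reg_setReg_of_ne _ h, zero_add] at this
  simpa [Store.setReg, move] using this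

/-- For `R[x]` from `0` to `R[0] - 1` do `c`; the register `u` is used for the test. -/
def forLoop (x u : ℕ) (c : Program) : Program :=
  .seq (.seq (.const x 0) (.sub u 0 x))
    (.loop u (.seq c (.seq (.const u 1) (.seq (.add x x u) (.sub u 0 x)))))

/-- The invariant must not depend on the counter or the test register, so the bookkeeping preserves
it. Each pass costs the body plus three assignments and a test. -/
lemma exec_forLoop {x u : ℕ} {c : Program} {N T : ℕ} (Inv : ℕ → Store → Prop) (hxu : x ≠ u) (hN : ∀ k s, Inv k s → s.reg 0 = N)
    (hsx : ∀ k s val, Inv k s → Inv k (s.setReg x val))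
    (hsu : ∀ k s val, Inv k s → Inv k (s.setReg u val))
    (hc : ∀ k s, k < N → Inv k s → s.reg x = k →
      ∃ s' t, Exec c s s' t ∧ t ≤ T ∧ Inv (k + 1) s' ∧ s'.reg x = k)
    (s : Store) (hs : Inv 0 s) :
    ∃ s' t, Exec (forLoop x u c) s s' t ∧ t ≤ N * (T + 4) + 3 ∧ Inv N s' := by
  -- Induction on the number `j` of remaining passes, which is the content of the test register.
  have loop : ∀ j k s, k + j = N → Inv k s → s.reg x = k → s.reg u = j →
      ∃ s' t, Exec (.loop u (.seq c (.seq (.const u 1) (.seq (.add x x u) (.sub u 0 x))))) s s' t ∧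
        t ≤ j * (T + 4) + 1 ∧ Inv N s' := by
    intro j
    induction j with
    | zero =>
      intro k s hk hs _ hju
      exact ⟨s, 1, .loop_done hju, by omega, by rwa [← hk]⟩
    | succ j ih =>
      intro k s hk hs hkx hju
      obtain ⟨s₁, t₁, h1, ht1, hi1, hx1⟩ := hc k s (by omega) hs hkx
      have h2 := Exec.seq h1 (Exec.seq (Exec.const u 1 s₁) (Exec.seq (Exec.add x x u _)
        (Exec.sub u 0 x _)))
      set s₂ := (s₁.setReg u 1).setReg x ((s₁.setReg u 1).reg x + (s₁.setReg u 1).reg u) with hs2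
      have hi2 : Inv (k + 1) s₂ := hsx _ _ _ (hsu _ _ _ hi1)
      have hx2 : s₂.reg x = k + 1 := by
        rw [hs2, Store.reg_setReg_self, Store.reg_setReg_self, Store.reg_setReg_of_ne _ _ hxu, hx1]
      have h02 := hN _ _ hi2
      obtain ⟨s₃, t₃, h3, ht3, hi3⟩ := ih (k + 1) (s₂.setReg u (s₂.reg 0 - s₂.reg x)) (by omega)
        (hsu _ _ _ hi2) (by rw [Store.reg_setReg_of_ne _ _ hxu, hx2])
        (by rw [Store.reg_setReg_self, h02, hx2]; omega)
      refine ⟨s₃, _, .loop_step (by omega) h2 h3, ?_, hi3⟩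
      rw [add_mul]
      omega
  have h1 := Exec.seq (Exec.const x 0 s) (Exec.sub u 0 x _)
  have hi1 : Inv 0 ((s.setReg x 0).setReg u ((s.setReg x 0).reg 0 - (s.setReg x 0).reg x)) :=
    hsu _ _ _ (hsx _ _ _ hs)
  obtain ⟨s', t, h2, ht, hi2⟩ := loop N 0 _ (zero_add N) hi1
    (by rw [Store.reg_setReg_of_ne _ _ hxu, Store.reg_setReg_self])
    (by rw [Store.reg_setReg_self, Store.reg_setReg_self, hN _ _ (hsx _ _ 0 hs)]; rfl)
  exact ⟨s', _, .seq h1 h2, by omega, hi2⟩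

end Program

/-- Expressions with values in the natural numbers. They can use the input, and sums over all
numbers smaller than the length of the input. -/
inductive Expr
  | const (c : ℕ)
  | var (x : ℕ)
  | load (e : Expr)
  | add (a b : Expr)
  | sub (a b : Expr)
  | mul (a b : Expr)
  | ite (c a b : Expr)
  | sum (x : ℕ) (e : Expr)

namespace Expr

/-- The value of an expression, where `N` is the length of the input, `A` is the input, and `ρ`
assigns values to the variables. The first factor of a product is cut off at `N`. -/
def eval (N : ℕ) (A : ℕ → ℕ) : Expr → (ℕ → ℕ) → ℕ
  | const c, _ => c
  | var x, ρ => ρ x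
  | load e, ρ => A (e.eval N A ρ)
  | add a b, ρ => a.eval N A ρ + b.eval N A ρ
  | sub a b, ρ => a.eval N A ρ - b.eval N A ρ
  | mul a b, ρ => min (a.eval N A ρ) N * b.eval N A ρ
  | ite c a b, ρ => if c.eval N A ρ ≠ 0 then a.eval N A ρ else b.eval N A ρ
  | sum x e, ρ => ∑ i ∈ Finset.range N, e.eval N A (Function.update ρ x i)

/-- The program that puts the value of an expression into the register `2 * d + 2`. The
variable `x` is in the register `2 * x + 1`. -/
def compile : Expr → ℕ → Program
  | const c, d => .const (2 * d + 2) c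
  | var x, d => .move (2 * d + 2) (2 * x + 1)
  | load e, d => .seq (e.compile d) (.load (2 * d + 2) 0 (2 * d + 2))
  | add a b, d => .seq (a.compile d) (.seq (b.compile (d + 1))
      (.add (2 * d + 2) (2 * d + 2) (2 * (d + 1) + 2)))
  | sub a b, d => .seq (a.compile d) (.seq (b.compile (d + 1))
      (.sub (2 * d + 2) (2 * d + 2) (2 * (d + 1) + 2)))
  -- Multiplication is repeated addition. The loop always makes `R[0]` passes and adds only while
  -- its counter is below the first factor, whence the cut-off in `eval` and a cost independent of
  -- the values.
  | mul a b, d => .seq (a.compile d) (.seq (b.compile (d + 1)) (.seq (.const (2 * d + 6) 0)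
      (.seq (.forLoop (2 * d + 8) (2 * d + 10)
        (.seq (.sub (2 * d + 12) (2 * d + 2) (2 * d + 8))
          (.cond (2 * d + 12) (.add (2 * d + 6) (2 * d + 6) (2 * (d + 1) + 2)) .skip)))
      (.move (2 * d + 2) (2 * d + 6)))))
  | ite c a b, d => .seq (c.compile d) (.cond (2 * d + 2) (a.compile d) (b.compile d))
  -- The register of the bound variable serves as loop counter; its old value waits in `2 * d + 2`
  -- and is restored at the end.
  | sum x e, d => .seq (.move (2 * d + 2) (2 * x + 1)) (.seq (.const (2 * d + 4) 0)
      (.seq (.forLoop (2 * x + 1) (2 * d + 6)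
        (.seq (e.compile (d + 3)) (.add (2 * d + 4) (2 * d + 4) (2 * (d + 3) + 2))))
      (.seq (.move (2 * x + 1) (2 * d + 2)) (.move (2 * d + 2) (2 * d + 4)))))

open Polynomial in
/-- A bound for the number of steps, in terms of the length of the input. -/
noncomputable def cost : Expr → Polynomial ℕ
  | const _ => 1
  | var _ => 2
  | load e => e.cost + 1
  | add a b => a.cost + b.cost + 1
  | sub a b => a.cost + b.cost + 1
  | mul a b => a.cost + b.cost + 7 * X + 6
  | ite c a b => c.cost + a.cost + b.cost + 1
  | sum _ e => X * (e.cost + 5) + 10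

end Expr

/-- Except for the output tape, the configurations differ only in the registers for
intermediate results numbered `d` or higher. -/
structure Frame (d : ℕ) (s s' : Store) : Prop where
  arr : s'.arr = s.arr
  len : s'.reg 0 = s.reg 0
  var : ∀ x, s'.reg (2 * x + 1) = s.reg (2 * x + 1)
  tmp : ∀ k < d, s'.reg (2 * k + 2) = s.reg (2 * k + 2)

/-- The values of the variables. -/
def Store.vars (s : Store) (x : ℕ) : ℕ := s.reg (2 * x + 1)

lemma Frame.vars {d : ℕ} {s s' : Store} (h : Frame d s s') : s'.vars = s.vars :=
  funext h.var

lemma Frame.trans {d d' : ℕ} {s s' s'' : Store} (h : Frame d s s') (h' : Frame d' s' s'')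
    (hd : d ≤ d') : Frame d s s'' :=
  ⟨h'.arr.trans h.arr, h'.len.trans h.len, fun x => (h'.var x).trans (h.var x),
    fun k hk => (h'.tmp k (hk.trans_le hd)).trans (h.tmp k hk)⟩

lemma frame_setReg {d k : ℕ} (s : Store) (val : ℕ) (h : d ≤ k) :
    Frame d s (s.setReg (2 * k + 2) val) :=
  ⟨rfl, s.reg_setReg_of_ne _ (by omega), fun x => s.reg_setReg_of_ne _ (by omega),
    fun i hi => s.reg_setReg_of_ne _ (by omega)⟩

/-- Structural induction for all `d`: subprograms run at a higher level leave the intermediate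
results below it intact. Since `R[0]` never changes, every loop has the same length and the costs
add up to a polynomial in it. -/
lemma Expr.exec_compile (e : Expr) : ∀ (d : ℕ) (s : Store), ∃ s' t, Exec (e.compile d) s s' t ∧
    t ≤ e.cost.eval (s.reg 0) ∧ s'.reg (2 * d + 2) = e.eval (s.reg 0) (s.arr 0) s.vars ∧
    s'.out = s.out ∧ Frame d s s' := by
  induction e with
  | const c =>
    intro d s
    exact ⟨_, _, .const _ _ _, by simp [cost], s.reg_setReg_self _ _, rfl,
      frame_setReg s c le_rfl⟩
  | var x =>
    intro d s
    exact ⟨_, _, Program.exec_move (by omega) s, by simp [cost], s.reg_setReg_self _ _, rfl,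
      frame_setReg s _ le_rfl⟩
  | load e ih =>
    intro d s
    obtain ⟨s₁, t, h, ht, hv, ho, hf⟩ := ih d s
    refine ⟨_, _, .seq h (.load _ _ _ _), by simpa [cost] using ht, ?_, ho,
      hf.trans (frame_setReg s₁ _ le_rfl) le_rfl⟩
    rw [Store.reg_setReg_self, hv, hf.arr, eval]
  | add a b iha ihb =>
    intro d s
    obtain ⟨s₁, t, h, ht, hv, ho, hf⟩ := iha d s
    obtain ⟨s₂, t', h', ht', hv', ho', hf'⟩ := ihb (d + 1) s₁
    rw [hf.len] at ht'
    refine ⟨_, _, .seq h (.seq h' (.add _ _ _ _)), ?_, ?_, ho'.trans ho,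
      (hf.trans hf' (by omega)).trans (frame_setReg s₂ _ le_rfl) le_rfl⟩
    · simp only [cost, Polynomial.eval_add, Polynomial.eval_one]
      omega
    · rw [Store.reg_setReg_self, hv', hf'.tmp d (by omega), hv, hf.arr, hf.len, hf.vars, eval]
  | sub a b iha ihb =>
    intro d s
    obtain ⟨s₁, t, h, ht, hv, ho, hf⟩ := iha d s
    obtain ⟨s₂, t', h', ht', hv', ho', hf'⟩ := ihb (d + 1) s₁
    rw [hf.len] at ht'
    refine ⟨_, _, .seq h (.seq h' (.sub _ _ _ _)), ?_, ?_, ho'.trans ho,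
      (hf.trans hf' (by omega)).trans (frame_setReg s₂ _ le_rfl) le_rfl⟩
    · simp only [cost, Polynomial.eval_add, Polynomial.eval_one]
      omega
    · rw [Store.reg_setReg_self, hv', hf'.tmp d (by omega), hv, hf.arr, hf.len, hf.vars, eval]
  | mul a b iha ihb =>
    intro d s
    obtain ⟨s₁, t, h, ht, hv, ho, hf⟩ := iha d s
    obtain ⟨s₂, t', h', ht', hv', ho', hf'⟩ := ihb (d + 1) s₁
    rw [hf.len] at ht'
    have hff := hf.trans hf' (by omega)
    have hva : s₂.reg (2 * d + 2) = a.eval (s.reg 0) (s.arr 0) s.vars := by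
      rw [hf'.tmp d (by omega), hv]
    have hvb : s₂.reg (2 * (d + 1) + 2) = b.eval (s.reg 0) (s.arr 0) s.vars := by
      rw [hv', hf.arr, hf.len, hf.vars]
    generalize a.eval (s.reg 0) (s.arr 0) s.vars = va at hva
    generalize b.eval (s.reg 0) (s.arr 0) s.vars = vb at hvb
    -- After `k` passes the accumulator `2 * d + 6` holds the product with the first factor cut off
    -- at `k`.
    let Inv : ℕ → Store → Prop := fun k s' => s'.out = s.out ∧ Frame d s s' ∧
      s'.reg (2 * d + 2) = va ∧ s'.reg (2 * (d + 1) + 2) = vb ∧ s'.reg (2 * d + 6) = min va k * vb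
    have hset : ∀ k s' val j, Inv k s' → d + 3 ≤ j → Inv k (s'.setReg (2 * j + 2) val) := by
      rintro k s' val j ⟨h1, h2, h3, h4, h5⟩ hj
      refine ⟨h1, h2.trans (frame_setReg s' val (by omega : d ≤ j)) le_rfl, ?_, ?_, ?_⟩ <;>
        rwa [Store.reg_setReg_of_ne _ _ (by omega)]
    obtain ⟨s₃, t₃, h₃, ht₃, ho₃, hf₃, -, -, hi₃⟩ := Program.exec_forLoop (N := s.reg 0) (T := 3)
      (x := 2 * d + 8) (u := 2 * d + 10)
      (c := .seq (.sub (2 * d + 12) (2 * d + 2) (2 * d + 8))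
          (.cond (2 * d + 12) (.add (2 * d + 6) (2 * d + 6) (2 * (d + 1) + 2)) .skip))
      Inv (by omega) (fun k s' h => h.2.1.len)
      (fun k s' val h => hset k s' val (d + 3) h (by omega))
      (fun k s' val h => hset k s' val (d + 4) h (by omega))
      (by
        intro k s' hk hi hx
        have hi' := hset k s' (s'.reg (2 * d + 2) - s'.reg (2 * d + 8)) (d + 5) hi (by omega)
        have hva' := hi.2.2.1
        set s'' := s'.setReg (2 * d + 12) (s'.reg (2 * d + 2) - s'.reg (2 * d + 8)) with hs''
        have hx'' : s''.reg (2 * d + 8) = k := by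
          rw [hs'', Store.reg_setReg_of_ne _ _ (by omega), hx]
        have hr : s''.reg (2 * d + 12) = va - k := by
          rw [hs'', Store.reg_setReg_self, hva', hx]
        by_cases hlt : k < va
        · refine ⟨_, _, .seq (.sub _ _ _ _) (.cond_true (by rw [← hs'', hr]; omega)
            (.add _ _ _ _)), by omega, ?_, ?_⟩
          · obtain ⟨h1, h2, h3, h4, h5⟩ := hi'
            refine ⟨h1, h2.trans (frame_setReg (k := d + 2) s'' _ (by omega)) le_rfl, ?_, ?_, ?_⟩
            · rwa [Store.reg_setReg_of_ne _ _ (by omega)]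
            · rwa [Store.reg_setReg_of_ne _ _ (by omega)]
            · rw [Store.reg_setReg_self]
              change s''.reg _ + s''.reg _ = _
              have h5' : s''.reg (2 * d + 6) = min va k * vb := h5
              have h4' : s''.reg (2 * (d + 1) + 2) = vb := h4
              rw [h5', h4', min_eq_right hlt.le, min_eq_right (by omega : k + 1 ≤ va), add_mul,
                one_mul]
          · rw [Store.reg_setReg_of_ne _ _ (by omega)]
            exact hx''
        · refine ⟨s'', _, .seq (.sub _ _ _ _) (.cond_false (by rw [← hs'', hr]; omega)
            (.skip _)), by omega, ?_, hx''⟩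
          obtain ⟨h1, h2, h3, h4, h5⟩ := hi'
          refine ⟨h1, h2, h3, h4, ?_⟩
          have h5' : s''.reg (2 * d + 6) = min va k * vb := h5
          rw [h5', min_eq_left (by omega), min_eq_left (by omega)])
      (s₂.setReg (2 * d + 6) 0)
      ⟨ho'.trans ho, hff.trans (frame_setReg (k := d + 2) s₂ 0 (by omega)) le_rfl,
        by rwa [Store.reg_setReg_of_ne _ _ (by omega)],
        by rwa [Store.reg_setReg_of_ne _ _ (by omega)], by rw [Store.reg_setReg_self]; simp⟩
    refine ⟨_, _, .seq h (.seq h' (.seq (.const _ _ _) (.seq h₃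
      (Program.exec_move (by omega) _)))), ?_, ?_, ho₃,
      hf₃.trans (frame_setReg s₃ _ le_rfl) le_rfl⟩
    · simp only [cost, Polynomial.eval_add, Polynomial.eval_mul, Polynomial.eval_X,
        Polynomial.eval_ofNat]
      omega
    · rw [Store.reg_setReg_self, hi₃, ← hva, ← hvb, hf'.tmp d (by omega), hv, hv', hf.arr, hf.len,
        hf.vars, eval]
  | ite c a b ihc iha ihb =>
    intro d s
    obtain ⟨s₁, t, h, ht, hv, ho, hf⟩ := ihc d s
    by_cases hc : s₁.reg (2 * d + 2) = 0
    · obtain ⟨s₂, t', h', ht', hv', ho', hf'⟩ := ihb d s₁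
      rw [hf.len] at ht'
      refine ⟨s₂, _, .seq h (.cond_false hc h'), ?_, ?_, ho'.trans ho, hf.trans hf' le_rfl⟩
      · simp only [cost, Polynomial.eval_add, Polynomial.eval_one]
        omega
      · rw [eval, ← hv, if_neg (not_not.2 hc), hv', hf.arr, hf.len, hf.vars]
    · obtain ⟨s₂, t', h', ht', hv', ho', hf'⟩ := iha d s₁
      rw [hf.len] at ht'
      refine ⟨s₂, _, .seq h (.cond_true hc h'), ?_, ?_, ho'.trans ho, hf.trans hf' le_rfl⟩
      · simp only [cost, Polynomial.eval_add, Polynomial.eval_one]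
        omega
      · rw [eval, ← hv, if_pos hc, hv', hf.arr, hf.len, hf.vars]
  | sum x e ih =>
    intro d s
    let Inv : ℕ → Store → Prop := fun k s' => s'.out = s.out ∧ s'.arr = s.arr ∧
      s'.reg 0 = s.reg 0 ∧ (∀ y, y ≠ x → s'.reg (2 * y + 1) = s.reg (2 * y + 1)) ∧
      (∀ k < d, s'.reg (2 * k + 2) = s.reg (2 * k + 2)) ∧
      s'.reg (2 * d + 2) = s.reg (2 * x + 1) ∧ s'.reg (2 * d + 4) =
        ∑ i ∈ Finset.range k, e.eval (s.reg 0) (s.arr 0) (Function.update s.vars x i)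
    obtain ⟨s₂, t₂, h₂, ht₂, ho₂, ha₂, hl₂, hv₂, htm₂, hx₂, hs₂⟩ := Program.exec_forLoop
      (N := s.reg 0) (T := e.cost.eval (s.reg 0) + 1) (x := 2 * x + 1) (u := 2 * d + 6)
      (c := .seq (e.compile (d + 3)) (.add (2 * d + 4) (2 * d + 4) (2 * (d + 3) + 2)))
      Inv (by omega) (fun k s' h => h.2.2.1)
      (by
        rintro k s' val ⟨h1, h2, h3, h4, h5, h6, h7⟩
        refine ⟨h1, h2, ?_, fun y hy => ?_, fun k hk => ?_, ?_, ?_⟩ <;>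
          rw [Store.reg_setReg_of_ne _ _ (by omega)]
        exacts [h3, h4 y hy, h5 k hk, h6, h7])
      (by
        rintro k s' val ⟨h1, h2, h3, h4, h5, h6, h7⟩
        refine ⟨h1, h2, ?_, fun y hy => ?_, fun k hk => ?_, ?_, ?_⟩ <;>
          rw [Store.reg_setReg_of_ne _ _ (by omega)]
        exacts [h3, h4 y hy, h5 k hk, h6, h7])
      (by
        rintro k s' hk ⟨h1, h2, h3, h4, h5, h6, h7⟩ hx
        obtain ⟨s₁, t, h, ht, hv, ho, hf⟩ := ih (d + 3) s'
        have hvars : s'.vars = Function.update s.vars x k := by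
          funext y
          by_cases hy : y = x
          · rw [hy, Function.update_self]
            exact hx
          · rw [Function.update_of_ne hy]
            exact h4 y hy
        rw [h3] at ht
        refine ⟨_, _, .seq h (.add _ _ _ _), by omega, ⟨ho.trans h1, hf.arr.trans h2, ?_,
          fun y hy => ?_, fun k hk => ?_, ?_, ?_⟩, ?_⟩
        · rw [Store.reg_setReg_of_ne _ _ (by omega), hf.len, h3]
        · rw [Store.reg_setReg_of_ne _ _ (by omega), hf.var, h4 y hy]
        · rw [Store.reg_setReg_of_ne _ _ (by omega), hf.tmp k (by omega), h5 k hk]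
        · rw [Store.reg_setReg_of_ne _ _ (by omega), hf.tmp d (by omega), h6]
        · rw [Store.reg_setReg_self, hv, h2, h3, hvars, Finset.sum_range_succ, ← h7]
          exact congrArg (· + _) (hf.tmp (d + 1) (by omega))
        · rw [Store.reg_setReg_of_ne _ _ (by omega), hf.var, hx])
      ((s.setReg (2 * d + 2) (s.reg (2 * x + 1))).setReg (2 * d + 4) 0)
      (by
        refine ⟨rfl, rfl, ?_, fun y hy => ?_, fun k hk => ?_, ?_, ?_⟩
        · rw [Store.reg_setReg_of_ne _ _ (by omega), Store.reg_setReg_of_ne _ _ (by omega)]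
        · rw [Store.reg_setReg_of_ne _ _ (by omega), Store.reg_setReg_of_ne _ _ (by omega)]
        · rw [Store.reg_setReg_of_ne _ _ (by omega), Store.reg_setReg_of_ne _ _ (by omega)]
        · rw [Store.reg_setReg_of_ne _ _ (by omega), Store.reg_setReg_self]
        · rw [Store.reg_setReg_self, Finset.sum_range_zero])
    refine ⟨_, _, .seq (Program.exec_move (by omega) s) (.seq (.const _ _ _) (.seq h₂ (.seq
      (Program.exec_move (by omega) _) (Program.exec_move (by omega) _)))), ?_, ?_, ho₂,
      ⟨ha₂, ?_, fun y => ?_, fun k hk => ?_⟩⟩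
    · simp only [cost, Polynomial.eval_add, Polynomial.eval_mul, Polynomial.eval_X,
        Polynomial.eval_ofNat]
      rw [show e.cost.eval (s.reg 0) + 1 + 4 = e.cost.eval (s.reg 0) + 5 from rfl] at ht₂
      omega
    · rw [Store.reg_setReg_self, Store.reg_setReg_of_ne _ _ (by omega), hs₂, eval]
    · rw [Store.reg_setReg_of_ne _ _ (by omega), Store.reg_setReg_of_ne _ _ (by omega), hl₂]
    · rw [Store.reg_setReg_of_ne _ _ (by omega)]
      by_cases hy : y = x
      · rw [hy, Store.reg_setReg_self, hx₂]
      · rw [Store.reg_setReg_of_ne _ _ (by omega), hv₂ y hy]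
    · rw [Store.reg_setReg_of_ne _ _ (by omega), Store.reg_setReg_of_ne _ _ (by omega), htm₂ k hk]

/-- Expressions for lists of natural numbers. -/
inductive ListExpr
  /-- a list with one entry -/
  | single (e : Expr)
  | append (l l' : ListExpr)
  /-- the list `l` if `e` is not zero, and the empty list otherwise -/
  | guard (e : Expr) (l : ListExpr)
  /-- the concatenation of the lists for all values of `x` smaller than the length of the input -/
  | flat (x : ℕ) (l : ListExpr)
  /-- the list for the value `e` of `x` -/
  | letIn (x : ℕ) (e : Expr) (l : ListExpr)

namespace ListExpr

/-- The value of a list expression. -/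
def eval (N : ℕ) (A : ℕ → ℕ) : ListExpr → (ℕ → ℕ) → List ℕ
  | single e, ρ => [e.eval N A ρ]
  | append l l', ρ => l.eval N A ρ ++ l'.eval N A ρ
  | guard e l, ρ => if e.eval N A ρ ≠ 0 then l.eval N A ρ else []
  | flat x l, ρ => (List.range N).flatMap fun i => l.eval N A (Function.update ρ x i)
  | letIn x e l, ρ => l.eval N A (Function.update ρ x (e.eval N A ρ))

/-- The program that outputs the value of a list expression. -/
def compile : ListExpr → ℕ → Program
  | single e, d => .seq (e.compile d) (.write (2 * d + 2))
  | append l l', d => .seq (l.compile d) (l'.compile d)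
  | guard e l, d => .seq (e.compile d) (.cond (2 * d + 2) (l.compile d) .skip)
  | flat x l, d => .seq (.move (2 * d + 2) (2 * x + 1))
      (.seq (.forLoop (2 * x + 1) (2 * d + 4) (l.compile (d + 2)))
      (.move (2 * x + 1) (2 * d + 2)))
  -- The expression is evaluated one level up, leaving `2 * d + 2` free for the old value of `x`.
  | letIn x e l, d => .seq (e.compile (d + 1)) (.seq (.move (2 * d + 2) (2 * x + 1))
      (.seq (.move (2 * x + 1) (2 * (d + 1) + 2)) (.seq (l.compile (d + 1))
      (.move (2 * x + 1) (2 * d + 2)))))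

open Polynomial in
/-- A bound for the number of steps, in terms of the length of the input. -/
noncomputable def cost : ListExpr → Polynomial ℕ
  | single e => e.cost + 1
  | append l l' => l.cost + l'.cost
  | guard e l => e.cost + l.cost + 2
  | flat _ l => X * (l.cost + 4) + 7
  | letIn _ e l => e.cost + l.cost + 6

end ListExpr

lemma ListExpr.exec_compile (l : ListExpr) : ∀ (d : ℕ) (s : Store), ∃ s' t,
    Exec (l.compile d) s s' t ∧ t ≤ l.cost.eval (s.reg 0) ∧
    s'.out = s.out ++ l.eval (s.reg 0) (s.arr 0) s.vars ∧ Frame d s s' := by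
  induction l with
  | single e =>
    intro d s
    obtain ⟨s₁, t, h, ht, hv, ho, hf⟩ := e.exec_compile d s
    refine ⟨_, _, .seq h (.write _ _), by simpa [cost] using ht, ?_,
      ⟨hf.arr, hf.len, hf.var, hf.tmp⟩⟩
    rw [hv, ho, eval]
  | append l l' ih ih' =>
    intro d s
    obtain ⟨s₁, t, h, ht, ho, hf⟩ := ih d s
    obtain ⟨s₂, t', h', ht', ho', hf'⟩ := ih' d s₁
    rw [hf.len] at ht'
    refine ⟨s₂, _, .seq h h', ?_, ?_, hf.trans hf' le_rfl⟩
    · simp only [cost, Polynomial.eval_add]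
      omega
    · rw [ho', ho, hf.len, hf.arr, hf.vars, eval, List.append_assoc]
  | guard e l ih =>
    intro d s
    obtain ⟨s₁, t, h, ht, hv, ho, hf⟩ := e.exec_compile d s
    by_cases hc : s₁.reg (2 * d + 2) = 0
    · refine ⟨s₁, _, .seq h (.cond_false hc (.skip _)), ?_, ?_, hf⟩
      · simp only [cost, Polynomial.eval_add, Polynomial.eval_ofNat]
        omega
      · rw [eval, ← hv, if_neg (not_not.2 hc), List.append_nil, ho]
    · obtain ⟨s₂, t', h', ht', ho', hf'⟩ := ih d s₁
      rw [hf.len] at ht'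
      refine ⟨s₂, _, .seq h (.cond_true hc h'), ?_, ?_, hf.trans hf' le_rfl⟩
      · simp only [cost, Polynomial.eval_add, Polynomial.eval_ofNat]
        omega
      · rw [eval, ← hv, if_pos hc, ho', ho, hf.arr, hf.len, hf.vars]
  | flat x l ih =>
    intro d s
    let Inv : ℕ → Store → Prop := fun k s' => s'.arr = s.arr ∧
      s'.reg 0 = s.reg 0 ∧ (∀ y, y ≠ x → s'.reg (2 * y + 1) = s.reg (2 * y + 1)) ∧
      (∀ k < d, s'.reg (2 * k + 2) = s.reg (2 * k + 2)) ∧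
      s'.reg (2 * d + 2) = s.reg (2 * x + 1) ∧ s'.out = s.out ++
        (List.range k).flatMap fun i => l.eval (s.reg 0) (s.arr 0) (Function.update s.vars x i)
    obtain ⟨s₂, t₂, h₂, ht₂, ha₂, hl₂, hv₂, htm₂, hx₂, ho₂⟩ := Program.exec_forLoop
      (N := s.reg 0) (T := l.cost.eval (s.reg 0)) (x := 2 * x + 1) (u := 2 * d + 4)
      (c := l.compile (d + 2))
      Inv (by omega) (fun k s' h => h.2.1)
      (by
        rintro k s' val ⟨h1, h2, h3, h4, h5, h6⟩
        refine ⟨h1, ?_, fun y hy => ?_, fun k hk => ?_, ?_, h6⟩ <;>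
          rw [Store.reg_setReg_of_ne _ _ (by omega)]
        exacts [h2, h3 y hy, h4 k hk, h5])
      (by
        rintro k s' val ⟨h1, h2, h3, h4, h5, h6⟩
        refine ⟨h1, ?_, fun y hy => ?_, fun k hk => ?_, ?_, h6⟩ <;>
          rw [Store.reg_setReg_of_ne _ _ (by omega)]
        exacts [h2, h3 y hy, h4 k hk, h5])
      (by
        rintro k s' hk ⟨h1, h2, h3, h4, h5, h6⟩ hx
        obtain ⟨s₁, t, h, ht, ho, hf⟩ := ih (d + 2) s'
        have hvars : s'.vars = Function.update s.vars x k := by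
          funext y
          by_cases hy : y = x
          · rw [hy, Function.update_self]
            exact hx
          · rw [Function.update_of_ne hy]
            exact h3 y hy
        rw [h2] at ht
        refine ⟨s₁, t, h, ht, ⟨hf.arr.trans h1, hf.len.trans h2, fun y hy => (hf.var y).trans
          (h3 y hy), fun k hk => (hf.tmp k (by omega)).trans (h4 k hk),
          (hf.tmp d (by omega)).trans h5, ?_⟩, (hf.var x).trans hx⟩
        rw [ho, h6, h1, h2, hvars, List.range_succ, List.flatMap_append, List.append_assoc]
        simp)
      (s.setReg (2 * d + 2) (s.reg (2 * x + 1)))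
      (by
        refine ⟨rfl, ?_, fun y hy => ?_, fun k hk => ?_, ?_, ?_⟩
        · rw [Store.reg_setReg_of_ne _ _ (by omega)]
        · rw [Store.reg_setReg_of_ne _ _ (by omega)]
        · rw [Store.reg_setReg_of_ne _ _ (by omega)]
        · rw [Store.reg_setReg_self]
        · simp [Store.out_setReg])
    refine ⟨_, _, .seq (Program.exec_move (by omega) s) (.seq h₂
      (Program.exec_move (by omega) _)), ?_, ho₂, ⟨ha₂, ?_, fun y => ?_, fun k hk => ?_⟩⟩
    · simp only [cost, Polynomial.eval_add, Polynomial.eval_mul, Polynomial.eval_X,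
        Polynomial.eval_ofNat]
      omega
    · rw [Store.reg_setReg_of_ne _ _ (by omega), hl₂]
    · by_cases hy : y = x
      · rw [hy, Store.reg_setReg_self, hx₂]
      · rw [Store.reg_setReg_of_ne _ _ (by omega), hv₂ y hy]
    · rw [Store.reg_setReg_of_ne _ _ (by omega), htm₂ k hk]
  | letIn x e l ih =>
    intro d s
    obtain ⟨s₁, t, h, ht, hv, ho, hf⟩ := e.exec_compile (d + 1) s
    have h₁ := Program.exec_move (x := 2 * d + 2) (y := 2 * x + 1) (by omega) s₁
    set s₂ := s₁.setReg (2 * d + 2) (s₁.reg (2 * x + 1)) with hs₂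
    have h₂ := Program.exec_move (x := 2 * x + 1) (y := 2 * (d + 1) + 2) (by omega) s₂
    set s₃ := s₂.setReg (2 * x + 1) (s₂.reg (2 * (d + 1) + 2)) with hs₃
    obtain ⟨s₄, t', h', ht', ho', hf'⟩ := ih (d + 1) s₃
    have hlen : s₃.reg 0 = s.reg 0 := by
      rw [hs₃, Store.reg_setReg_of_ne _ _ (by omega), hs₂, Store.reg_setReg_of_ne _ _ (by omega),
        hf.len]
    have harr : s₃.arr = s.arr := hf.arr
    have hvars : s₃.vars = Function.update s.vars x (e.eval (s.reg 0) (s.arr 0) s.vars) := by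
      funext y
      by_cases hy : y = x
      · rw [hy, Function.update_self, Store.vars, hs₃, Store.reg_setReg_self, hs₂,
          Store.reg_setReg_of_ne _ _ (by omega), hv]
      · rw [Function.update_of_ne hy, Store.vars, hs₃, Store.reg_setReg_of_ne _ _ (by omega), hs₂,
          Store.reg_setReg_of_ne _ _ (by omega), hf.var, Store.vars]
    rw [hlen] at ht'
    refine ⟨_, _, .seq h (.seq h₁ (.seq h₂ (.seq h' (Program.exec_move (by omega) _)))), ?_, ?_,
      ⟨hf'.arr.trans harr, ?_, fun y => ?_, fun k hk => ?_⟩⟩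
    · simp only [cost, Polynomial.eval_add, Polynomial.eval_ofNat]
      omega
    · rw [Store.out_setReg, ho', hlen, harr, hvars, eval]
      exact congrArg (· ++ _) ho
    · rw [Store.reg_setReg_of_ne _ _ (by omega), hf'.len, hlen]
    · by_cases hy : y = x
      · rw [hy, Store.reg_setReg_self, hf'.tmp d (by omega), hs₃,
          Store.reg_setReg_of_ne _ _ (by omega), hs₂, Store.reg_setReg_self, hf.var]
      · rw [Store.reg_setReg_of_ne _ _ (by omega), hf'.var, hs₃,
          Store.reg_setReg_of_ne _ _ (by omega), hs₂, Store.reg_setReg_of_ne _ _ (by omega), hf.var]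
    · rw [Store.reg_setReg_of_ne _ _ (by omega), hf'.tmp k (by omega), hs₃,
        Store.reg_setReg_of_ne _ _ (by omega), hs₂, Store.reg_setReg_of_ne _ _ (by omega),
        hf.tmp k (by omega)]

/-- Every list expression can be computed in polynomial time. -/
theorem ListExpr.computes (l : ListExpr) (input : List ℕ) :
    ∃ t, (l.compile 0).Computes input
      (l.eval input.length (fun i => input.getD i 0) fun _ => 0) t ∧
      t ≤ l.cost.eval input.length := by
  obtain ⟨s, t, h, ht, ho, -⟩ := l.exec_compile 0 (Store.init input)
  have hvars : (Store.init input).vars = fun _ => 0 := by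
    funext x
    simp [Store.vars, Store.init]
  rw [hvars] at ho
  refine ⟨t, ⟨s, h, ?_⟩, ?_⟩
  · simpa [Store.init] using ho
  · simpa [Store.init] using ht

/-! ### Reading and writing codes -/

section Lists

variable {α β : Type*}

/-- Loops of the language run up to the length of the input. The surplus passes of a guarded loop
contribute nothing, so it ranges over `Fin n` in effect. -/
lemma flatMap_range_eq_finRange {n N : ℕ} (h : n ≤ N) (g : ℕ → List β)
    (hg : ∀ k, n ≤ k → g k = []) :
    (List.range N).flatMap g = (List.finRange n).flatMap fun i : Fin n => g i := by
  obtain ⟨k, rfl⟩ := Nat.exists_eq_add_of_le h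
  rw [List.range_add, List.flatMap_append, ← List.map_coe_finRange_eq_range, List.flatMap_map,
    List.flatMap_map, List.flatMap_eq_nil_iff.2 fun i _ => hg _ (Nat.le_add_right _ _),
    List.append_nil]

lemma flatMap_product (l : List α) (l' : List β) {γ : Type*} (f : α × β → List γ) :
    (l ×ˢ l').flatMap f = l.flatMap fun a => l'.flatMap fun b => f (a, b) := by
  change (l.flatMap fun a => l'.map (Prod.mk a)).flatMap f = _
  rw [List.flatMap_assoc]
  simp only [List.flatMap_map]

lemma flatMap_filter_eq (l : List α) (p : α → Prop) [DecidablePred p] (f : α → List β) :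
    (l.filter (p ·)).flatMap f = l.flatMap fun x => if p x then f x else [] := by
  induction l with
  | nil => rfl
  | cons a l ih =>
    by_cases h : p a <;> simp [h, ih]

/-- Relates counting by nested sums to listing by nested loops, as needed for `eval_numVertices`. -/
lemma sum_range_length (N : ℕ) (g : ℕ → List β) :
    ∑ i ∈ Finset.range N, (g i).length = ((List.range N).flatMap g).length := by
  induction N with
  | zero => rfl
  | succ N ih => simp [Finset.sum_range_succ, List.range_succ, ih]

end Lists

open Classical in
lemma encodeRel_eq_ofFn {m n : ℕ} (r : Fin m → Fin n → Prop) :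
    encodeRel r = List.ofFn fun k => if r (finProdFinEquiv.symm k).1 (finProdFinEquiv.symm k).2
      then 1 else 0 := by
  rw [List.ofFn_mul, encodeRel, List.flatMap, List.ofFn_eq_map]
  congr 1
  refine List.map_congr_left fun i _ => ?_
  rw [List.ofFn_eq_map]
  refine List.map_congr_left fun j _ => ?_
  have : ∀ h, (⟨i * n + j, h⟩ : Fin (m * n)) = finProdFinEquiv (i, j) := fun h =>
    Fin.ext (by simp only [finProdFinEquiv_apply_val]; ring)
  rw [this, Equiv.symm_apply_apply]

lemma length_encodeRel {m n : ℕ} (r : Fin m → Fin n → Prop) : (encodeRel r).length = m * n := by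
  rw [encodeRel_eq_ofFn, List.length_ofFn]

open Classical in
lemma getD_encodeRel {m n : ℕ} (r : Fin m → Fin n → Prop) (i : Fin m) (j : Fin n) :
    (encodeRel r).getD (i * n + j) 0 = if r i j then 1 else 0 := by
  have hk : i * n + j = (finProdFinEquiv (i, j)).val := by
    simp only [finProdFinEquiv_apply_val]
    ring
  rw [hk, List.getD_eq_getElem _ _ (by rw [length_encodeRel]; exact Fin.is_lt _)]
  simp only [encodeRel_eq_ofFn, List.getElem_ofFn, Fin.eta, Equiv.symm_apply_apply]

section Input

variable {n m : ℕ} (G : SimpleGraph (Fin n)) (D : TreeDecomposition G (Fin m))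

lemma index_lt {m n : ℕ} (i : Fin m) (j : Fin n) : i.val * n + j < m * n := by
  have h : (i.val + 1) * n ≤ m * n := Nat.mul_le_mul_right _ i.2
  rw [add_mul] at h
  omega

lemma length_encodeInput :
    (encodeInput G D).length = n * n + m * m + m * n + 2 := by
  simp only [encodeInput, encodeGraph, List.length_append, List.length_cons, length_encodeRel]
  ring

lemma getD_encodeInput_zero : (encodeInput G D).getD 0 0 = n := by
  simp [encodeInput, encodeGraph]

open Classical in
lemma getD_encodeInput_graph (a b : Fin n) :
    (encodeInput G D).getD (1 + (a * n + b)) 0 = if G.Adj a b then 1 else 0 := by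
  have := index_lt a b
  rw [encodeInput, List.append_assoc, List.getD_append _ _ _ _ (by
    simp only [encodeGraph, List.length_cons, length_encodeRel]; omega), encodeGraph, add_comm,
    List.getD_cons_succ, getD_encodeRel]

lemma getD_encodeInput_card : (encodeInput G D).getD (1 + n * n) 0 = m := by
  have h : (encodeGraph G).length = 1 + n * n := by
    simp only [encodeGraph, List.length_cons, length_encodeRel]
    ring
  rw [encodeInput, List.append_assoc, List.getD_append_right _ _ _ _ h.le, h, Nat.sub_self]
  simp [encodeGraph]

open Classical in
lemma getD_encodeInput_tree (i j : Fin m) :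
    (encodeInput G D).getD (2 + n * n + (i * m + j)) 0 = if D.tree.Adj i j then 1 else 0 := by
  have h : (encodeGraph G).length = 1 + n * n := by
    simp only [encodeGraph, List.length_cons, length_encodeRel]
    ring
  have := index_lt i j
  rw [encodeInput, List.append_assoc, List.getD_append_right _ _ _ _ (by omega), h,
    List.getD_append _ _ _ _ (by
      simp only [encodeGraph, List.length_cons, length_encodeRel]; omega), encodeGraph,
    show 2 + n * n + (i * m + j) - (1 + n * n) = i * m + j + 1 by omega,
    List.getD_cons_succ, getD_encodeRel]

open Classical in
lemma getD_encodeInput_bag (i : Fin m) (a : Fin n) :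
    (encodeInput G D).getD (2 + n * n + m * m + (i * n + a)) 0 =
      if a ∈ D.bag i then 1 else 0 := by
  have h : (encodeGraph G ++ encodeGraph D.tree).length = 2 + n * n + m * m := by
    simp only [encodeGraph, List.length_append, List.length_cons, length_encodeRel]
    ring
  rw [encodeInput, List.getD_append_right _ _ _ _ (by omega), h, Nat.add_sub_cancel_left,
    getD_encodeRel]
  by_cases ha : a ∈ D.bag i <;> simp [ha]

end Input

/-! ### The expansion as a graph on an initial segment -/

namespace TreeDecomposition

variable {n m : ℕ} {G : SimpleGraph (Fin n)} (D : TreeDecomposition G (Fin m))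

open Classical in
/-- The vertices of the expansion. -/
noncomputable def vertexList : List (Fin n × (Fin m × Fin (m + n * n))) :=
  (List.finRange n ×ˢ (List.finRange m ×ˢ List.finRange (m + n * n))).filter
    (fun x => x.1 ∈ D.bag x.2.1)

lemma mem_vertexList (x : Fin n × (Fin m × Fin (m + n * n))) :
    x ∈ D.vertexList ↔ x.1 ∈ D.bag x.2.1 := by
  obtain ⟨a, i, s⟩ := x
  simp [vertexList]

lemma nodup_vertexList : D.vertexList.Nodup :=
  ((List.nodup_finRange _).product ((List.nodup_finRange _).product (List.nodup_finRange _))).filter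
    _

-- The vertex list is enumerated in the order of three nested loops with a membership test, the
-- shape that `ListExpr.forVertices` produces.
open Classical in
lemma flatMap_vertexList {α : Type*} (f : Fin n × (Fin m × Fin (m + n * n)) → List α) :
    D.vertexList.flatMap f = (List.finRange n).flatMap fun a => (List.finRange m).flatMap fun i =>
      (List.finRange (m + n * n)).flatMap fun s =>
        if a ∈ D.bag i then f (a, i, s) else [] := by
  rw [vertexList, flatMap_filter_eq, flatMap_product]
  simp only [flatMap_product]

/-- The numbering of the vertices of the expansion. -/
noncomputable def vertexEquiv : Fin D.vertexList.length ≃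
    {x : Fin n × (Fin m × Fin (m + n * n)) // x.1 ∈ D.bag x.2.1} :=
  (List.Nodup.getEquiv D.vertexList D.nodup_vertexList).trans
    (Equiv.subtypeEquivRight D.mem_vertexList)

/-- The expansion with numbered vertices. -/
noncomputable def numberedExpansion : SimpleGraph (Fin D.vertexList.length) :=
  D.expansion.comap D.vertexEquiv

/-- The adjacency of the expansion. -/
def expansionAdj (x y : Fin n × (Fin m × Fin (m + n * n))) : Prop :=
  (x.1 = y.1 ∧ (D.tree.pathBlowup (port n)).Adj x.2 y.2) ∨
    (x.2 = y.2 ∧ G.Adj x.1 y.1 ∧ D.IsMeeting x.1 y.1 x.2)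

-- The numbering follows the vertex list, so the adjacency matrix comes from running through that
-- list twice.
open Classical in
lemma encodeGraph_numberedExpansion : encodeGraph D.numberedExpansion =
    D.vertexList.length :: D.vertexList.flatMap fun x => D.vertexList.map fun y =>
      if D.expansionAdj x y then 1 else 0 := by
  have h : ∀ k l, D.numberedExpansion.Adj k l ↔
      D.expansionAdj (D.vertexList.get k) (D.vertexList.get l) := fun _ _ => Iff.rfl
  rw [encodeGraph, encodeRel]
  simp only [h]
  have h' : ∀ x, (List.finRange D.vertexList.length).map (fun l =>
      if D.expansionAdj x (D.vertexList.get l) then 1 else 0) =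
      D.vertexList.map fun y => if D.expansionAdj x y then 1 else 0 := by
    intro x
    conv_rhs => rw [← List.map_get_finRange D.vertexList, List.map_map]
    rfl
  simp only [h']
  congr 1
  conv_rhs => rw [← List.map_get_finRange D.vertexList, List.flatMap_map]
  simp only [List.map_get_finRange]

end TreeDecomposition

/-! ### The algorithm -/

namespace Expr

/-- `a < b` -/
def lt (a b : Expr) : Expr := sub b a

/-- conjunction -/
def and (a b : Expr) : Expr := ite a b (const 0)

/-- disjunction -/
def or (a b : Expr) : Expr := add a b

/-- negation -/
def not (a : Expr) : Expr := sub (const 1) a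

/-- `a = b` -/
def eq (a b : Expr) : Expr := and (lt a (add b (const 1))) (lt b (add a (const 1)))

variable {N : ℕ} {A : ℕ → ℕ} {ρ : ℕ → ℕ} {a b : Expr}

lemma eval_lt : (lt a b).eval N A ρ ≠ 0 ↔ a.eval N A ρ < b.eval N A ρ := by
  simp only [lt, eval]
  omega

lemma eval_and : (and a b).eval N A ρ ≠ 0 ↔ a.eval N A ρ ≠ 0 ∧ b.eval N A ρ ≠ 0 := by
  simp only [and, eval]
  split_ifs with h <;> simp [h]

lemma eval_or : (or a b).eval N A ρ ≠ 0 ↔ a.eval N A ρ ≠ 0 ∨ b.eval N A ρ ≠ 0 := by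
  simp only [or, eval]
  omega

lemma eval_not : (not a).eval N A ρ ≠ 0 ↔ ¬ a.eval N A ρ ≠ 0 := by
  simp only [not, eval]
  omega

lemma eval_eq : (eq a b).eval N A ρ ≠ 0 ↔ a.eval N A ρ = b.eval N A ρ := by
  simp only [eq, eval_and, eval_lt, eval]
  omega

lemma eval_sum_ne_zero {x : ℕ} {e : Expr} : (sum x e).eval N A ρ ≠ 0 ↔
    ∃ k < N, e.eval N A (Function.update ρ x k) ≠ 0 := by
  simp only [eval, ne_eq, Finset.sum_eq_zero_iff, Finset.mem_range]
  push Not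
  rfl

/-- The cut-off is harmless for first factors bounded by the input length, such as indices and
dimensions. -/
lemma eval_mul (h : a.eval N A ρ ≤ N) :
    (mul a b).eval N A ρ = a.eval N A ρ * b.eval N A ρ := by
  rw [eval, min_eq_left h]

/-! In what follows, the variables `0, …, 3` contain the number of vertices of the graph, the
square of this number, the number of nodes of the tree, and the length of the paths that replace
the nodes of the tree. -/

/-- the entry of the adjacency matrix of the graph -/
def graphAdj (a b : Expr) : Expr := load (add (const 1) (add (mul a (var 0)) b))

/-- the entry of the adjacency matrix of the tree -/
def treeAdj (i j : Expr) : Expr := load (add (add (const 2) (var 1)) (add (mul i (var 2)) j))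

/-- the entry of the incidence matrix of nodes and vertices -/
def memBag (i a : Expr) : Expr :=
  load (add (add (add (const 2) (var 1)) (mul (var 2) (var 2))) (add (mul i (var 0)) a))

/-- `(a, i, s)` is a vertex of the expansion -/
def isVertex (a i s : ℕ) : Expr :=
  and (lt (var a) (var 0)) (and (lt (var i) (var 2)) (and (lt (var s) (var 3))
    (memBag (var i) (var a))))

/-- no node before `i` contains both `a` and `b` -/
def isFirst (a b i : Expr) : Expr :=
  not (sum 10 (and (lt (var 10) i) (and (memBag (var 10) a) (memBag (var 10) b))))

/-- `s` is the slot of the edge `a b`, where `a < b` -/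
def isSlot (a b s : Expr) : Expr :=
  and (lt a b) (eq s (add (add (var 2) (mul a (var 0))) b))

/-- the vertices `(a, i, s)` and `(b, j, t)` of the expansion are adjacent, where the variables
`4, …, 9` contain `a`, `i`, `s`, `b`, `j` and `t` -/
def expansionAdj : Expr :=
  or (and (eq (var 4) (var 7)) (or
      (and (eq (var 5) (var 8)) (or (eq (add (var 6) (const 1)) (var 9))
        (eq (add (var 9) (const 1)) (var 6))))
      (and (treeAdj (var 5) (var 8)) (and (eq (var 6) (var 8)) (eq (var 9) (var 5))))))
    (and (eq (var 5) (var 8)) (and (eq (var 6) (var 9)) (and (graphAdj (var 4) (var 7))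
      (and (isFirst (var 4) (var 7) (var 5))
        (or (isSlot (var 4) (var 7) (var 6)) (isSlot (var 7) (var 4) (var 6)))))))

/-- the number of vertices of the expansion -/
def numVertices : Expr := sum 4 (sum 5 (sum 6 (ite (isVertex 4 5 6) (const 1) (const 0))))

end Expr

namespace ListExpr

open GraphExpansion.Expr

/-- the concatenation of the lists for all vertices `(a, i, s)` of the expansion -/
def forVertices (a i s : ℕ) (l : ListExpr) : ListExpr :=
  flat a (flat i (flat s (guard (isVertex a i s) l)))

/-- the code of the expansion -/
def expansionCode : ListExpr :=
  letIn 0 (load (const 0)) <| letIn 1 (mul (var 0) (var 0)) <|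
    letIn 2 (load (add (const 1) (var 1))) <| letIn 3 (add (var 2) (var 1)) <|
      append (single numVertices) <| forVertices 4 5 6 <| forVertices 7 8 9 <|
        single (ite Expr.expansionAdj (const 1) (const 0))

end ListExpr

/-! ### Correctness of the algorithm. -/

section Correctness

variable {n m : ℕ} {G : SimpleGraph (Fin n)} (D : TreeDecomposition G (Fin m))

/-- The values of the variables `0, …, 3` are as intended. -/
structure IsSetup (n m : ℕ) (ρ : ℕ → ℕ) : Prop where
  zero : ρ 0 = n
  one : ρ 1 = n * n
  two : ρ 2 = m
  three : ρ 3 = m + n * n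

lemma IsSetup.update {ρ : ℕ → ℕ} (h : IsSetup n m ρ) {x : ℕ} (hx : 3 < x) (k : ℕ) :
    IsSetup n m (Function.update ρ x k) := by
  constructor <;> rw [Function.update_of_ne (by omega)]
  exacts [h.zero, h.one, h.two, h.three]

/-- the input as an array -/
noncomputable abbrev inputArray (i : ℕ) : ℕ := (encodeInput G D).getD i 0

/-- the length of the input -/
noncomputable abbrev inputLength : ℕ := (encodeInput G D).length

/-- Loops up to the input length therefore reach all vertices, nodes and slots, and no product is
cut off. The adjacency matrices provide the squares of `n` and `m`. -/
lemma le_inputLength : n ≤ inputLength D ∧ m ≤ inputLength D ∧ m + n * n ≤ inputLength D := by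
  have h1 := Nat.le_mul_self n
  have h2 := Nat.le_mul_self m
  rw [inputLength, length_encodeInput]
  refine ⟨?_, ?_, ?_⟩ <;> omega

variable {D} {ρ : ℕ → ℕ}

lemma eval_graphAdj (h : IsSetup n m ρ) {ea eb : Expr} {a b : Fin n}
    (ha : ea.eval (inputLength D) (inputArray D) ρ = a)
    (hb : eb.eval (inputLength D) (inputArray D) ρ = b) :
    (Expr.graphAdj ea eb).eval (inputLength D) (inputArray D) ρ ≠ 0 ↔ G.Adj a b := by
  have hle := (le_inputLength D).1
  rw [Expr.graphAdj, Expr.eval, Expr.eval, Expr.eval, Expr.eval,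
    Expr.eval_mul (by rw [ha]; omega), ha, hb, Expr.eval, h.zero, inputArray,
    getD_encodeInput_graph]
  simp

lemma eval_treeAdj (h : IsSetup n m ρ) {ei ej : Expr} {i j : Fin m}
    (hi : ei.eval (inputLength D) (inputArray D) ρ = i)
    (hj : ej.eval (inputLength D) (inputArray D) ρ = j) :
    (Expr.treeAdj ei ej).eval (inputLength D) (inputArray D) ρ ≠ 0 ↔ D.tree.Adj i j := by
  have hle := (le_inputLength D).2.1
  simp only [Expr.treeAdj, Expr.eval, hi, hj, h.one, h.two]
  rw [min_eq_left (by omega), inputArray, getD_encodeInput_tree]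
  simp

lemma eval_memBag (h : IsSetup n m ρ) {ei ea : Expr} {i : Fin m} {a : Fin n}
    (hi : ei.eval (inputLength D) (inputArray D) ρ = i)
    (ha : ea.eval (inputLength D) (inputArray D) ρ = a) :
    (Expr.memBag ei ea).eval (inputLength D) (inputArray D) ρ ≠ 0 ↔ a ∈ D.bag i := by
  have hle := (le_inputLength D).2.1
  simp only [Expr.memBag, Expr.eval, hi, ha, h.zero, h.one, h.two]
  rw [min_eq_left (by omega), min_eq_left (by omega), inputArray, getD_encodeInput_bag]
  simp

lemma eval_isSlot (h : IsSetup n m ρ) {ea eb es : Expr} {a b : Fin n}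
    (ha : ea.eval (inputLength D) (inputArray D) ρ = a)
    (hb : eb.eval (inputLength D) (inputArray D) ρ = b) :
    (Expr.isSlot ea eb es).eval (inputLength D) (inputArray D) ρ ≠ 0 ↔
      a < b ∧ es.eval (inputLength D) (inputArray D) ρ = m + a * n + b := by
  have hle := (le_inputLength D).1
  rw [Expr.isSlot, Expr.eval_and, Expr.eval_lt, Expr.eval_eq, ha, hb]
  simp only [Expr.eval, ha, hb, h.zero, h.two]
  rw [min_eq_left (by omega), Fin.lt_def]

/-- The expression binds variable `10`, so the arguments must be other variables. -/
lemma eval_isFirst (h : IsSetup n m ρ) {a b i : ℕ} (ha : a ≠ 10) (hb : b ≠ 10) (hi : i ≠ 10)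
    {va vb : Fin n} {vi : Fin m} (hva : ρ a = va) (hvb : ρ b = vb) (hvi : ρ i = vi) :
    (Expr.isFirst (.var a) (.var b) (.var i)).eval (inputLength D) (inputArray D) ρ ≠ 0 ↔
      ∀ k < vi, ¬ (va ∈ D.bag k ∧ vb ∈ D.bag k) := by
  have hle := (le_inputLength D).2.1
  have key : ∀ k : Fin m, ((Expr.and (.lt (.var 10) (.var i)) (.and (.memBag (.var 10) (.var a))
      (.memBag (.var 10) (.var b)))).eval (inputLength D) (inputArray D)
      (Function.update ρ 10 k) ≠ 0) ↔ k < vi ∧ va ∈ D.bag k ∧ vb ∈ D.bag k := by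
    intro k
    have h' := h.update (x := 10) (by omega) k
    have h10 : (Expr.var 10).eval (inputLength D) (inputArray D) (Function.update ρ 10 k) = k := by
      simp [Expr.eval]
    rw [Expr.eval_and, Expr.eval_and, Expr.eval_lt,
      eval_memBag (a := va) h' h10 (by simp [Expr.eval, ha, hva]),
      eval_memBag (a := vb) h' h10 (by simp [Expr.eval, hb, hvb]), h10]
    simp [Expr.eval, hi, hvi]
  rw [Expr.isFirst, Expr.eval_not, Expr.eval_sum_ne_zero]
  push Not
  constructor
  · intro H k hk hka hkb
    exact (key k).2 ⟨hk, hka, hkb⟩ (H k (by omega))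
  · intro H k _
    by_contra hne
    have hlt : k < vi := by
      have := (Expr.eval_lt.1 (Expr.eval_and.1 hne).1)
      simpa [Expr.eval, hi, hvi] using this
    have := (key ⟨k, hlt.trans vi.2⟩).1 hne
    exact H _ this.1 this.2.1 this.2.2

lemma eval_expansionAdj (h : IsSetup n m ρ) {x y : Fin n × (Fin m × Fin (m + n * n))}
    (hx : x.1 ∈ D.bag x.2.1) (hy : y.1 ∈ D.bag y.2.1) (h4 : ρ 4 = x.1) (h5 : ρ 5 = x.2.1)
    (h6 : ρ 6 = x.2.2) (h7 : ρ 7 = y.1) (h8 : ρ 8 = y.2.1) (h9 : ρ 9 = y.2.2) :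
    Expr.expansionAdj.eval (inputLength D) (inputArray D) ρ ≠ 0 ↔ D.expansionAdj x y := by
  obtain ⟨a, i, s⟩ := x
  obtain ⟨b, j, t⟩ := y
  dsimp only at hx hy h4 h5 h6 h7 h8 h9
  simp only [Expr.expansionAdj, Expr.eval_or, Expr.eval_and, Expr.eval_eq,
    eval_treeAdj (D := D) h (ei := .var 5) (ej := .var 8) h5 h8,
    eval_graphAdj (D := D) h (ea := .var 4) (eb := .var 7) h4 h7,
    eval_isFirst (D := D) h (by omega : 4 ≠ 10) (by omega : 7 ≠ 10) (by omega : 5 ≠ 10) h4 h7 h5,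
    eval_isSlot (D := D) h (ea := .var 4) (eb := .var 7) h4 h7,
    eval_isSlot (D := D) h (ea := .var 7) (eb := .var 4) h7 h4]
  simp only [Expr.eval, h4, h5, h6, h7, h8, h9, Fin.val_inj]
  simp only [TreeDecomposition.expansionAdj, SimpleGraph.pathBlowup,
    TreeDecomposition.IsMeeting, TreeDecomposition.IsFirst, TreeDecomposition.port, Fin.ext_iff,
    Fin.val_castLE, Prod.ext_iff]
  -- The program checks only that no earlier bag contains both vertices. That the bag of `i` itself
  -- does follows because both arguments are vertices of the expansion with the same node.
  refine or_congr Iff.rfl ?_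
  constructor
  · rintro ⟨h1, h2, h3, h10, h11⟩
    obtain rfl := Fin.ext h1
    exact ⟨⟨h1, h2⟩, h3, ⟨⟨hx, hy⟩, h10⟩, h11⟩
  · rintro ⟨⟨h1, h2⟩, h3, ⟨-, h10⟩, h11⟩
    exact ⟨h1, h2, h3, h10, h11⟩

lemma eval_forVertices (h : IsSetup n m ρ) {a i s : ℕ} (ha : 3 < a) (hi : a < i) (hs : i < s)
    (l : ListExpr) :
    (l.forVertices a i s).eval (inputLength D) (inputArray D) ρ =
      D.vertexList.flatMap fun x => l.eval (inputLength D) (inputArray D)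
        (Function.update (Function.update (Function.update ρ a x.1) i x.2.1) s x.2.2) := by
  classical
  obtain ⟨hn, hm, hK⟩ := le_inputLength D
  have key : ∀ va vi vs : ℕ, (Expr.isVertex a i s).eval (inputLength D) (inputArray D)
      (Function.update (Function.update (Function.update ρ a va) i vi) s vs) ≠ 0 ↔
      va < n ∧ vi < m ∧ vs < m + n * n ∧ (Expr.memBag (.var i) (.var a)).eval (inputLength D)
        (inputArray D)
        (Function.update (Function.update (Function.update ρ a va) i vi) s vs) ≠ 0 := by
    intro va vi vs
    have h' := ((h.update (x := a) (by omega) va).update (x := i) (by omega) vi).update (x := s)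
      (by omega) vs
    rw [Expr.isVertex, Expr.eval_and, Expr.eval_and, Expr.eval_and, Expr.eval_lt, Expr.eval_lt,
      Expr.eval_lt]
    simp only [Expr.eval, h'.zero, h'.two, h'.three]
    rw [Function.update_of_ne (by omega), Function.update_of_ne (by omega), Function.update_self,
      Function.update_of_ne (by omega), Function.update_self, Function.update_self]
  rw [D.flatMap_vertexList]
  simp only [ListExpr.forVertices, ListExpr.eval]
  simp only [key]
  -- The range tests in `isVertex` empty the lists for indices out of range, whatever the input
  -- array holds there.
  rw [flatMap_range_eq_finRange hn _ (fun k hk => by simp [hk.not_gt])]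
  congr 1
  funext va
  rw [flatMap_range_eq_finRange hm _ (fun k hk => by simp [hk.not_gt])]
  congr 1
  funext vi
  rw [flatMap_range_eq_finRange hK _ (fun k hk => by simp [hk.not_gt])]
  congr 1
  funext vs
  have h' := ((h.update (x := a) (by omega) va).update (x := i) (by omega) vi).update (x := s)
    (by omega) vs
  refine if_congr ?_ rfl rfl
  rw [eval_memBag (D := D) (i := vi) (a := va) h']
  · simp only [Fin.is_lt, true_and]
  · rw [Expr.eval, Function.update_of_ne (by omega), Function.update_self]
  · rw [Expr.eval, Function.update_of_ne (by omega), Function.update_of_ne (by omega),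
      Function.update_self]

/-- Take lengths in `eval_forVertices` for a list expression that emits one number per vertex. -/
lemma eval_numVertices (h : IsSetup n m ρ) :
    Expr.numVertices.eval (inputLength D) (inputArray D) ρ = D.vertexList.length := by
  have h1 := congrArg List.length (eval_forVertices (D := D) h (a := 4) (i := 5) (s := 6)
    (by omega) (by omega) (by omega) (.single (.const 0)))
  have h2 : ∀ l : List (Fin n × (Fin m × Fin (m + n * n))),
      (l.flatMap fun _ => [0]).length = l.length := fun l => by simp
  simp only [ListExpr.eval, ListExpr.forVertices, Expr.eval] at h1
  rw [h2] at h1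
  rw [← h1]
  simp only [Expr.numVertices, Expr.eval]
  rw [← sum_range_length]
  refine Finset.sum_congr rfl fun a _ => ?_
  rw [← sum_range_length]
  refine Finset.sum_congr rfl fun i _ => ?_
  rw [← sum_range_length]
  refine Finset.sum_congr rfl fun s _ => ?_
  split_ifs <;> rfl

variable (D) in
lemma eval_expansionCode :
    ListExpr.expansionCode.eval (inputLength D) (inputArray D) (fun _ => 0) =
      encodeGraph D.numberedExpansion := by
  classical
  have hle := (le_inputLength D).1
  rw [D.encodeGraph_numberedExpansion, ListExpr.expansionCode]
  simp only [ListExpr.eval]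
  generalize hρ : Function.update _ 3 _ = ρ
  have h0 : (encodeInput G D).getD 0 0 = n := getD_encodeInput_zero G D
  have h : IsSetup n m ρ := by
    subst hρ
    constructor
    all_goals
      simp [Expr.eval, inputArray, h0, hle, getD_encodeInput_card,
        -List.getD_eq_getElem?_getD]
  rw [List.singleton_append, eval_numVertices h, eval_forVertices h (by omega) (by omega)
    (by omega)]
  congr 1
  refine List.flatMap_congr fun x hx => ?_
  have h' := ((h.update (x := 4) (by omega) x.1).update (x := 5) (by omega) x.2.1).update (x := 6)
    (by omega) x.2.2
  rw [eval_forVertices h' (by omega) (by omega) (by omega), List.map_eq_flatMap]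
  refine List.flatMap_congr fun y hy => ?_
  have h'' := ((h'.update (x := 7) (by omega) y.1).update (x := 8) (by omega) y.2.1).update
    (x := 9) (by omega) y.2.2
  rw [D.mem_vertexList] at hx hy
  rw [ListExpr.eval, Expr.eval, Expr.eval, Expr.eval]
  congr 1
  refine if_congr (eval_expansionAdj h'' hx hy ?_ ?_ ?_ ?_ ?_ ?_) rfl rfl <;>
    simp

end Correctness

lemma TreeDecomposition.numberedExpansion_spec {n m : ℕ} {G : SimpleGraph (Fin n)}
    (D : TreeDecomposition G (Fin m)) :
    IsExpansion G D.numberedExpansion ∧ IsTernary D.numberedExpansion ∧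
      treewidth D.numberedExpansion ≤ D.width + 1 := by
  have e : D.expansion ≃g D.numberedExpansion :=
    (SimpleGraph.Iso.comap D.vertexEquiv D.expansion).symm
  exact ⟨D.isExpansion_expansion.trans_iso e, D.isTernary_expansion.of_iso e,
    D.treewidth_le_of_iso e⟩

end GraphExpansion

theorem theorem1 :
    (∃ (alg : GraphExpansion.Program) (p : Polynomial ℕ),
      ∀ (n m : ℕ) (G : SimpleGraph (Fin n)) (D : GraphExpansion.TreeDecomposition G (Fin m)),
        ∃ (n' : ℕ) (G' : SimpleGraph (Fin n')) (t : ℕ),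
          alg.Computes (GraphExpansion.encodeInput G D) (GraphExpansion.encodeGraph G') t ∧
          t ≤ p.eval (GraphExpansion.encodeInput G D).length ∧
          GraphExpansion.IsExpansion G G' ∧
          GraphExpansion.IsTernary G' ∧
          GraphExpansion.treewidth G' ≤ D.width + 1) ∧
    (∀ (V : Type u) [Finite V] (G : SimpleGraph V),
      ∃ (n' : ℕ) (G' : SimpleGraph (Fin n')),
        GraphExpansion.IsExpansion G G' ∧
        GraphExpansion.IsTernary G' ∧
        GraphExpansion.treewidth G' ≤ GraphExpansion.treewidth G + 1) := by
  refine ⟨⟨GraphExpansion.ListExpr.expansionCode.compile 0,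
    GraphExpansion.ListExpr.expansionCode.cost, fun n m G D => ?_⟩, fun V _ G => ?_⟩
  · obtain ⟨t, h, ht⟩ := GraphExpansion.ListExpr.expansionCode.computes
      (GraphExpansion.encodeInput G D)
    have h' := GraphExpansion.eval_expansionCode D
    rw [GraphExpansion.inputLength] at h'
    rw [h'] at h
    exact ⟨_, D.numberedExpansion, t, h, ht, D.numberedExpansion_spec⟩
  -- An optimal tree decomposition, carried over to a copy of `G` on `Fin n`, keeps its width.
  · obtain ⟨n, ⟨f⟩⟩ := Finite.exists_equiv_fin V
    obtain ⟨m, D, hD⟩ := GraphExpansion.exists_width_eq_treewidth G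
    have e : G ≃g G.comap f.symm := (SimpleGraph.Iso.comap f.symm G).symm
    have hw : (D.congr e (Equiv.refl _)).width = D.width := by
      simp only [GraphExpansion.TreeDecomposition.width, D.card_bag_congr, Equiv.refl_symm,
        Equiv.refl_apply]
    obtain ⟨h1, h2, h3⟩ := (D.congr e (Equiv.refl _)).numberedExpansion_spec
    exact ⟨_, _, h1.of_iso e, h2, by rw [← hD, ← hw]; exact h3⟩
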